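/- Let $A$ be a unital C*-algebra, let $G$ be a finite group, and let $\alpha\colon G\to\mathrm{Aut}(A)$ be an action. Assume that $\alpha$ is strictly approximately inner, that is, for every finite set $F\subset A$ and every $\varepsilon>0$ there are unitaries $z_g\in A$ for $g\in G$ such that $\|\alpha_g(a)-z_g a z_g^*\|<\varepsilon$ for all $g\in G$ and $a\in F$, and $\|z_gz_h-z_{gh}\|<\varepsilon$ for all $g,h\in G$. Let $\iota\colon A\to C^*(G,A,\alpha)$ be the inclusion of $A$ in the crossed product. For a C*-algebra $B$ and $a,b\in M_\infty(B)_+$, where $M_\infty(B)=\bigcup_n M_n(B)$, write $a\precsim_B b$ if there is a sequence $(c_n)$ in $M_\infty(B)$ with $\lim_n c_nbc_n^*=a$, and $a\sim_B b$ if $a\precsim_B b$ and $b\precsim_B a$. Let $W(B)=M_\infty(B)_+/{\sim_B}$, with the addition $\langle a\rangle+\langle b\rangle=\langle a\oplus b\rangle$ and the partial order $\langle a\rangle\le\langle b\rangle\iff a\precsim_B b$, and let $\mathrm{Cu}(B)=W(\mathcal K\otimes B)$, where $\mathcal K$ is the algebra of compact operators on a separable infinite-dimensional Hilbert space. A homomorphism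 $\psi\colon B\to C$ of C*-algebras induces maps $W(\psi)\colon W(B)\to W(C)$, $\langle a\rangle\mapsto\langle\psi(a)\rangle$, and $\mathrm{Cu}(\psi)=W(\mathrm{id}_{\mathcal K}\otimes\psi)\colon\mathrm{Cu}(B)\to\mathrm{Cu}(C)$. Then: (a) $W(\iota)\colon W(A)\to W(C^*(G,A,\alpha))$ is an ordered semigroup isomorphism onto its range. (b) $\mathrm{Cu}(\iota)\colon\mathrm{Cu}(A)\to\mathrm{Cu}(C^*(G,A,\alpha))$ is an ordered semigroup isomorphism onto its range. Here an ordered semigroup isomorphism onto its range is an additive injective map $f$ such that $f(x)\le f(y)$ if and only if $x\le y$. -/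

import Mathlib

open Filter Topology

noncomputable section

section

attribute [local instance] CStarAlgebra.spectralOrder CStarAlgebra.spectralOrderedRing

/-! ### The algebra of finite matrices of arbitrary size -/

/-- The `ℕ × ℕ`-matrices over `A` whose entries vanish outside a finite upper left corner. -/
structure MatInf (A : Type*) [NonUnitalCStarAlgebra A] where
  /-- The entries of the matrix. -/
  entry : ℕ → ℕ → A
  /-- The matrix lives in a finite corner. -/
  exists_bound : ∃ n, ∀ i j, n ≤ i ∨ n ≤ j → entry i j = 0

namespace MatInf

variable {A B C : Type*} [NonUnitalCStarAlgebra A] [NonUnitalCStarAlgebra B]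
  [NonUnitalCStarAlgebra C]

/-- The matrix `a` is supported in the upper left `n × n` corner, that is, `a ∈ M_n(A)`. -/
def Bdd (n : ℕ) (a : MatInf A) : Prop := ∀ i j, n ≤ i ∨ n ≤ j → a.entry i j = 0

lemma exists_bdd (a : MatInf A) : ∃ n, Bdd n a := a.exists_bound

lemma Bdd.mono {n m : ℕ} {a : MatInf A} (h : Bdd n a) (hnm : n ≤ m) : Bdd m a :=
  fun i j hij => h i j (by omega)

lemma exists_bdd₂ (a b : MatInf A) : ∃ n, Bdd n a ∧ Bdd n b := by
  obtain ⟨n, hn⟩ := a.exists_bdd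
  obtain ⟨m, hm⟩ := b.exists_bdd
  exact ⟨max n m, hn.mono (le_max_left _ _), hm.mono (le_max_right _ _)⟩

lemma exists_bdd₃ (a b c : MatInf A) : ∃ n, Bdd n a ∧ Bdd n b ∧ Bdd n c := by
  obtain ⟨n, hn, hn'⟩ := exists_bdd₂ a b
  obtain ⟨m, hm⟩ := c.exists_bdd
  exact ⟨max n m, hn.mono (le_max_left _ _), hn'.mono (le_max_left _ _), hm.mono (le_max_right _ _)⟩

lemma entry_injective : Function.Injective (entry : MatInf A → ℕ → ℕ → A) := by
  rintro ⟨a, _⟩ ⟨b, _⟩ h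
  cases h
  rfl

@[ext] lemma ext {a b : MatInf A} (h : ∀ i j, a.entry i j = b.entry i j) : a = b :=
  entry_injective (funext fun i => funext fun j => h i j)

instance : Zero (MatInf A) := ⟨⟨fun _ _ => 0, 0, fun _ _ _ => rfl⟩⟩

instance : Add (MatInf A) := ⟨fun a b => ⟨fun i j => a.entry i j + b.entry i j, by
  obtain ⟨n, ha, hb⟩ := exists_bdd₂ a b
  exact ⟨n, fun i j h => by rw [ha i j h, hb i j h, add_zero]⟩⟩⟩

instance : Neg (MatInf A) := ⟨fun a => ⟨fun i j => -a.entry i j, by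
  obtain ⟨n, ha⟩ := exists_bdd a
  exact ⟨n, fun i j h => by rw [ha i j h, neg_zero]⟩⟩⟩

instance : Sub (MatInf A) := ⟨fun a b => ⟨fun i j => a.entry i j - b.entry i j, by
  obtain ⟨n, ha, hb⟩ := exists_bdd₂ a b
  exact ⟨n, fun i j h => by rw [ha i j h, hb i j h, sub_zero]⟩⟩⟩

instance {R : Type*} [SMulZeroClass R A] : SMul R (MatInf A) := ⟨fun r a => ⟨fun i j => r • a.entry i j, by
  obtain ⟨n, ha⟩ := exists_bdd a
  exact ⟨n, fun i j h => by rw [ha i j h, smul_zero]⟩⟩⟩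

@[simp] lemma zero_apply (i j : ℕ) : (0 : MatInf A).entry i j = 0 := rfl
@[simp] lemma add_apply (a b : MatInf A) (i j : ℕ) : (a + b).entry i j = a.entry i j + b.entry i j := rfl
@[simp] lemma neg_apply (a : MatInf A) (i j : ℕ) : (-a).entry i j = -a.entry i j := rfl
@[simp] lemma sub_apply (a b : MatInf A) (i j : ℕ) : (a - b).entry i j = a.entry i j - b.entry i j := rfl
@[simp] lemma smul_apply {R : Type*} [SMulZeroClass R A] (r : R) (a : MatInf A) (i j : ℕ) :
    (r • a).entry i j = r • a.entry i j := rfl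

instance : AddCommGroup (MatInf A) :=
  Function.Injective.addCommGroup (entry : MatInf A → ℕ → ℕ → A) entry_injective rfl
    (fun _ _ => rfl) (fun _ => rfl) (fun _ _ => rfl) (fun _ _ => rfl) (fun _ _ => rfl)

instance : Module ℂ (MatInf A) where
  one_smul a := by ext i j; simp
  mul_smul r s a := by ext i j; simp [mul_smul]
  smul_zero r := by ext i j; simp
  smul_add r a b := by ext i j; simp
  add_smul r s a := by ext i j; simp [add_smul]
  zero_smul a := by ext i j; simp

lemma sum_eq_of_bdd {a b : MatInf A} {n : ℕ} (h : Bdd n a ∨ Bdd n b) (i j : ℕ) :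
    ∑ᶠ k, a.entry i k * b.entry k j = ∑ k ∈ Finset.range n, a.entry i k * b.entry k j := by
  refine finsum_eq_sum_of_support_subset _ fun k hk => ?_
  by_contra hkn
  have : n ≤ k := by simpa using hkn
  rcases h with h | h
  · exact hk (by simp [h i k (Or.inr this)])
  · exact hk (by simp [h k j (Or.inl this)])

/-- Matrix multiplication; all the sums are finite. -/
instance : Mul (MatInf A) := ⟨fun a b => ⟨fun i j => ∑ᶠ k, a.entry i k * b.entry k j, by
  obtain ⟨n, ha, hb⟩ := exists_bdd₂ a b
  refine ⟨n, fun i j h => ?_⟩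
  rw [sum_eq_of_bdd (Or.inl ha)]
  refine Finset.sum_eq_zero fun k _ => ?_
  rcases h with h | h
  · simp [ha i k (Or.inl h)]
  · simp [hb k j (Or.inr h)]⟩⟩

lemma mul_apply (a b : MatInf A) (i j : ℕ) : (a * b).entry i j = ∑ᶠ k, a.entry i k * b.entry k j := rfl

lemma mul_apply_of_bdd {a b : MatInf A} {n : ℕ} (h : Bdd n a ∨ Bdd n b) (i j : ℕ) :
    (a * b).entry i j = ∑ k ∈ Finset.range n, a.entry i k * b.entry k j := sum_eq_of_bdd h i j

instance : NonUnitalRing (MatInf A) where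
  left_distrib a b c := by
    obtain ⟨n, ha⟩ := a.exists_bdd
    ext i j
    simp [mul_apply_of_bdd (Or.inl ha), mul_add, Finset.sum_add_distrib]
  right_distrib a b c := by
    obtain ⟨n, hc⟩ := c.exists_bdd
    ext i j
    simp [mul_apply_of_bdd (Or.inr hc), add_mul, Finset.sum_add_distrib]
  zero_mul a := by ext i j; simp [mul_apply]
  mul_zero a := by ext i j; simp [mul_apply]
  mul_assoc a b c := by
    obtain ⟨n, ha, hb, hc⟩ := exists_bdd₃ a b c
    ext i j
    simp only [mul_apply_of_bdd (Or.inr hc), mul_apply_of_bdd (Or.inl ha), Finset.sum_mul, Finset.mul_sum, mul_assoc]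
    exact Finset.sum_comm

/-- The conjugate transpose. -/
instance : Star (MatInf A) := ⟨fun a => ⟨fun i j => star (a.entry j i), by
  obtain ⟨n, ha⟩ := exists_bdd a
  exact ⟨n, fun i j h => by rw [ha j i h.symm, star_zero]⟩⟩⟩

@[simp] lemma star_apply (a : MatInf A) (i j : ℕ) : (star a).entry i j = star (a.entry j i) := rfl

instance : StarRing (MatInf A) where
  star_involutive a := by ext i j; simp
  star_mul a b := by
    obtain ⟨n, ha⟩ := a.exists_bdd
    have ha' : Bdd n (star a) := fun i j h => by rw [star_apply, ha j i h.symm, star_zero]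
    ext i j
    simp [mul_apply_of_bdd (Or.inl ha), mul_apply_of_bdd (Or.inr ha')]
  star_add a b := by ext i j; simp

instance : StarModule ℂ (MatInf A) where
  star_smul r a := by ext i j; simp

instance : IsScalarTower ℂ (MatInf A) (MatInf A) where
  smul_assoc r a b := by
    obtain ⟨n, hb⟩ := b.exists_bdd
    ext i j
    simp [mul_apply_of_bdd (Or.inr hb), Finset.smul_sum, smul_mul_assoc]

instance : SMulCommClass ℂ (MatInf A) (MatInf A) where
  smul_comm r a b := by
    obtain ⟨n, ha⟩ := a.exists_bdd
    ext i j
    simp [mul_apply_of_bdd (Or.inl ha), Finset.smul_sum, mul_smul_comm]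

/-- The upper left `n × n` corner of a matrix, an element of the C⋆-algebra `M_n(A)`. -/
def trunc (n : ℕ) (a : MatInf A) : CStarMatrix (Fin n) (Fin n) A :=
  CStarMatrix.ofMatrix fun i j => a.entry i j

@[simp] lemma trunc_apply (n : ℕ) (a : MatInf A) (i j : Fin n) : trunc n a i j = a.entry i j := rfl

/-- The inclusion of `M_n(A)` in `M_∞(A)` as the upper left corner. -/
def pad (n : ℕ) : CStarMatrix (Fin n) (Fin n) A →⋆ₙₐ[ℂ] MatInf A where
  toFun x := ⟨fun i j => if h : i < n ∧ j < n then x ⟨i, h.1⟩ ⟨j, h.2⟩ else 0, n,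
    fun i j h => dif_neg (by omega)⟩
  map_smul' r x := by
    ext i j
    by_cases h : i < n ∧ j < n <;> simp [h]
  map_zero' := by ext i j; simp
  map_add' x y := by
    ext i j
    by_cases h : i < n ∧ j < n <;> simp [h]
  map_mul' x y := by
    ext i j
    rw [mul_apply_of_bdd (n := n) (Or.inl fun i j h => dif_neg (by omega)), Finset.sum_range]
    by_cases h : i < n ∧ j < n
    · simp [h, CStarMatrix.mul_apply]
    · rw [not_and_or] at h
      rcases h with h | h <;> simp [h]
  map_star' x := by
    ext i j
    by_cases h : i < n ∧ j < n
    · simp [h, CStarMatrix.star_apply]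
    · have h' : ¬ (j < n ∧ i < n) := fun k => h k.symm
      simp [h, h']

lemma pad_apply (n : ℕ) (x : CStarMatrix (Fin n) (Fin n) A) (i j : ℕ) :
    (pad n x).entry i j = if h : i < n ∧ j < n then x ⟨i, h.1⟩ ⟨j, h.2⟩ else 0 := rfl

lemma bdd_pad (n : ℕ) (x : CStarMatrix (Fin n) (Fin n) A) : Bdd n (pad n x) :=
  fun i j h => dif_neg (by omega)

lemma pad_trunc {n : ℕ} {a : MatInf A} (h : Bdd n a) : pad n (trunc n a) = a := by
  ext i j
  rw [pad_apply]
  by_cases hij : i < n ∧ j < n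
  · simp [hij]
  · rw [dif_neg hij, h i j (by omega)]

lemma trunc_pad (n : ℕ) (x : CStarMatrix (Fin n) (Fin n) A) : trunc n (pad n x) = x := by
  ext i j
  simp [pad_apply]

lemma trunc_add (n : ℕ) (a b : MatInf A) : trunc n (a + b) = trunc n a + trunc n b := rfl
lemma trunc_smul (n : ℕ) (r : ℂ) (a : MatInf A) : trunc n (r • a) = r • trunc n a := rfl
lemma trunc_star (n : ℕ) (a : MatInf A) : trunc n (star a) = star (trunc n a) := rfl

lemma trunc_mul {n : ℕ} {a b : MatInf A} (h : Bdd n a ∨ Bdd n b) :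
    trunc n (a * b) = trunc n a * trunc n b := by
  ext i j
  simp [mul_apply_of_bdd h, Finset.sum_range, CStarMatrix.mul_apply]

/-- The inclusion of `M_n(A)` in `M_m(A)` as the upper left corner. -/
def padFin {n m : ℕ} (h : n ≤ m) :
    CStarMatrix (Fin n) (Fin n) A →⋆ₙₐ[ℂ] CStarMatrix (Fin m) (Fin m) A where
  toFun x := trunc m (pad n x)
  map_smul' r x := by rw [map_smul]; rfl
  map_zero' := by rw [map_zero]; rfl
  map_add' x y := by rw [map_add]; rfl
  map_mul' x y := by rw [map_mul, trunc_mul (Or.inl ((bdd_pad n x).mono h))]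
  map_star' x := by rw [map_star]; rfl

lemma norm_trunc_pad {n m : ℕ} (h : n ≤ m) (x : CStarMatrix (Fin n) (Fin n) A) :
    ‖trunc m (pad n x)‖ = ‖x‖ := by
  refine NonUnitalStarAlgHom.norm_map (padFin h) (fun x y hxy => ?_) x
  have := congrArg (pad m) hxy
  change pad m (trunc m (pad n x)) = pad m (trunc m (pad n y)) at this
  rw [pad_trunc ((bdd_pad n x).mono h), pad_trunc ((bdd_pad n y).mono h)] at this
  rw [← trunc_pad n x, this, trunc_pad]

/-- The least `n` with `a ∈ M_n(A)`. -/
def size (a : MatInf A) : ℕ := sInf {n | Bdd n a}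

lemma bdd_size (a : MatInf A) : Bdd a.size a := Nat.sInf_mem (s := {n | Bdd n a}) a.exists_bdd

/-- The norm of a matrix in `M_∞(A)` is its norm in the C⋆-algebra `M_n(A)`, for any `n` such that
it belongs to `M_n(A)`. -/
instance : Norm (MatInf A) := ⟨fun a => ‖trunc a.size a‖⟩

lemma norm_eq {n : ℕ} {a : MatInf A} (h : Bdd n a) : ‖a‖ = ‖trunc n a‖ := by
  have h1 : a.size ≤ n := Nat.sInf_le h
  change ‖trunc a.size a‖ = _
  conv_rhs => rw [← pad_trunc a.bdd_size]
  rw [norm_trunc_pad h1]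

lemma norm_pad (n : ℕ) (x : CStarMatrix (Fin n) (Fin n) A) : ‖pad n x‖ = ‖x‖ := by
  rw [norm_eq (bdd_pad n x), trunc_pad]

lemma Bdd.add {n : ℕ} {a b : MatInf A} (ha : Bdd n a) (hb : Bdd n b) : Bdd n (a + b) :=
  fun i j h => by rw [add_apply, ha i j h, hb i j h, add_zero]
lemma Bdd.smul {n : ℕ} {a : MatInf A} (ha : Bdd n a) (r : ℂ) : Bdd n (r • a) :=
  fun i j h => by rw [smul_apply, ha i j h, smul_zero]
lemma Bdd.star {n : ℕ} {a : MatInf A} (ha : Bdd n a) : Bdd n (star a) :=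
  fun i j h => by rw [star_apply, ha j i h.symm, star_zero]
lemma Bdd.mul {n : ℕ} {a b : MatInf A} (ha : Bdd n a) (hb : Bdd n b) : Bdd n (a * b) := by
  rw [← pad_trunc ha, ← pad_trunc hb, ← map_mul]
  exact bdd_pad _ _

lemma normCore : NormedSpace.Core ℂ (MatInf A) where
  norm_nonneg a := norm_nonneg (trunc a.size a)
  norm_smul r a := by
    rw [norm_eq (a.bdd_size.smul r), norm_eq a.bdd_size, trunc_smul, norm_smul]
  norm_triangle a b := by
    obtain ⟨n, ha, hb⟩ := exists_bdd₂ a b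
    rw [norm_eq ha, norm_eq hb, norm_eq (ha.add hb), trunc_add]
    exact norm_add_le _ _
  norm_eq_zero_iff a := by
    rw [norm_eq a.bdd_size, norm_eq_zero]
    constructor
    · intro h
      rw [← pad_trunc a.bdd_size, h, map_zero]
    · rintro h
      rw [h]
      rfl

instance : NormedAddCommGroup (MatInf A) := NormedAddCommGroup.ofCore normCore

instance : NormedSpace ℂ (MatInf A) := NormedSpace.ofCore normCore

instance : NonUnitalNormedRing (MatInf A) where
  __ := (inferInstance : NonUnitalRing (MatInf A))
  __ := (inferInstance : NormedAddCommGroup (MatInf A))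
  norm_mul_le a b := by
    obtain ⟨n, ha, hb⟩ := exists_bdd₂ a b
    rw [norm_eq ha, norm_eq hb, norm_eq (ha.mul hb), trunc_mul (Or.inl ha)]
    exact norm_mul_le _ _

instance : CStarRing (MatInf A) where
  norm_mul_self_le a := by
    obtain ⟨n, ha⟩ := a.exists_bdd
    rw [norm_eq ha, norm_eq (ha.star.mul ha), trunc_mul (Or.inr ha), trunc_star,
      CStarRing.norm_star_mul_self]

end MatInf

/-! ### The stabilization -/

/-- The stabilization `𝒦 ⊗ A`, where `𝒦` is the algebra of compact operators on a separable infinite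
dimensional Hilbert space. As `𝒦` is the inductive limit of the matrix algebras `M_n(ℂ)` and
`M_n(ℂ) ⊗ A = M_n(A)` has a unique C⋆-norm, it is the C⋆-algebra inductive limit of the `M_n(A)`,
that is, the completion of `M_∞(A)`. -/
def Stab (A : Type*) [NonUnitalCStarAlgebra A] : Type _ := UniformSpace.Completion (MatInf A)

namespace Stab

open UniformSpace Completion

variable {A B C : Type*} [NonUnitalCStarAlgebra A] [NonUnitalCStarAlgebra B]
  [NonUnitalCStarAlgebra C]

instance : NormedAddCommGroup (Stab A) :=
  inferInstanceAs (NormedAddCommGroup (Completion (MatInf A)))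

instance : CompleteSpace (Stab A) := inferInstanceAs (CompleteSpace (Completion (MatInf A)))

instance : NormedSpace ℂ (Stab A) := inferInstanceAs (NormedSpace ℂ (Completion (MatInf A)))

/-- The inclusion of `M_∞(A)` in its completion. -/
def of (a : MatInf A) : Stab A := (a : Completion (MatInf A))

lemma continuous_of : Continuous (of : MatInf A → Stab A) := continuous_coe _

lemma norm_of (a : MatInf A) : ‖of a‖ = ‖a‖ := norm_coe a

lemma of_add (a b : MatInf A) : of (a + b) = of a + of b := coe_add a b
lemma of_zero : of (0 : MatInf A) = 0 := rfl
lemma of_smul (r : ℂ) (a : MatInf A) : of (r • a) = r • of a := coe_smul r a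

lemma isDenseInducing_of : IsDenseInducing (of : MatInf A → Stab A) := isDenseInducing_coe

@[elab_as_elim] lemma ind {p : Stab A → Prop} (x : Stab A) (hp : IsClosed {x | p x}) (h : ∀ a, p (of a)) : p x :=
  Completion.induction_on x hp h

@[elab_as_elim] lemma ind₂ {p : Stab A → Stab A → Prop} (x y : Stab A)
    (hp : IsClosed {x : Stab A × Stab A | p x.1 x.2}) (h : ∀ a b, p (of a) (of b)) : p x y :=
  Completion.induction_on₂ x y hp h

@[elab_as_elim] lemma ind₃ {p : Stab A → Stab A → Stab A → Prop} (x y z : Stab A)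
    (hp : IsClosed {x : Stab A × Stab A × Stab A | p x.1 x.2.1 x.2.2})
    (h : ∀ a b c, p (of a) (of b) (of c)) : p x y z :=
  Completion.induction_on₃ x y z hp h

/-- The continuous extension of the multiplication of `M_∞(A)`. -/
instance : Mul (Stab A) :=
  ⟨fun x y => (isDenseInducing_of.prodMap isDenseInducing_of).extend
    (fun p : MatInf A × MatInf A => of (p.1 * p.2)) (x, y)⟩

lemma of_mul (a b : MatInf A) : of (a * b) = of a * of b :=
  ((isDenseInducing_of.prodMap isDenseInducing_of).extend_eq
    (continuous_of.comp (continuous_fst.mul continuous_snd)) (a, b)).symm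

instance : ContinuousMul (Stab A) where
  continuous_mul := by
    let m : MatInf A →+ MatInf A →+ Stab A :=
      (AddMonoidHom.mul : MatInf A →+ MatInf A →+ MatInf A).compr₂
        (toCompl : MatInf A →+ Completion (MatInf A))
    have hm : Continuous fun p : MatInf A × MatInf A => m p.1 p.2 :=
      continuous_of.comp continuous_mul
    have di : IsDenseInducing (toCompl : MatInf A → Completion (MatInf A)) := isDenseInducing_coe
    exact (di.extend_Z_bilin di hm :)

/-- The continuous extension of the adjoint of `M_∞(A)`. -/
instance : Star (Stab A) := ⟨Completion.map (star : MatInf A → MatInf A)⟩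

lemma uniformContinuous_star : UniformContinuous (star : MatInf A → MatInf A) :=
  (starₗᵢ (E := MatInf A) ℂ).isometry.uniformContinuous

lemma of_star (a : MatInf A) : of (star a) = star (of a) :=
  (map_coe uniformContinuous_star a).symm

instance : ContinuousStar (Stab A) := ⟨(continuous_map : Continuous (Completion.map (star : MatInf A → MatInf A)))⟩

instance : NonUnitalRing (Stab A) where
  __ := (inferInstance : AddCommGroup (Stab A))
  zero_mul x := ind x (isClosed_eq (by fun_prop) (by fun_prop)) fun a => by
    rw [← of_zero, ← of_mul, zero_mul]
  mul_zero x := ind x (isClosed_eq (by fun_prop) (by fun_prop)) fun a => by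
    rw [← of_zero, ← of_mul, mul_zero]
  left_distrib x y z := ind₃ x y z (isClosed_eq (by fun_prop) (by fun_prop)) fun a b c => by
    rw [← of_add, ← of_mul, ← of_mul, ← of_mul, ← of_add, mul_add]
  right_distrib x y z := ind₃ x y z (isClosed_eq (by fun_prop) (by fun_prop)) fun a b c => by
    rw [← of_add, ← of_mul, ← of_mul, ← of_mul, ← of_add, add_mul]
  mul_assoc x y z := ind₃ x y z (isClosed_eq (by fun_prop) (by fun_prop)) fun a b c => by
    simp only [← of_mul, mul_assoc]

instance : NonUnitalNormedRing (Stab A) where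
  __ := (inferInstance : NonUnitalRing (Stab A))
  __ := (inferInstance : NormedAddCommGroup (Stab A))
  norm_mul_le x y := ind₂ x y (isClosed_le (by fun_prop) (by fun_prop)) fun a b => by
    simpa only [← of_mul, norm_of] using norm_mul_le a b

instance : StarRing (Stab A) where
  star_involutive x := ind x (isClosed_eq (by fun_prop) (by fun_prop)) fun a => by
    rw [← of_star, ← of_star, star_star]
  star_mul x y := ind₂ x y (isClosed_eq (by fun_prop) (by fun_prop)) fun a b => by
    rw [← of_mul, ← of_star, ← of_star, ← of_star, ← of_mul, star_mul]
  star_add x y := ind₂ x y (isClosed_eq (by fun_prop) (by fun_prop)) fun a b => by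
    rw [← of_add, ← of_star, ← of_star, ← of_star, ← of_add, star_add]

instance : CStarRing (Stab A) where
  norm_mul_self_le x := ind x (isClosed_le (by fun_prop) (by fun_prop)) fun a => by
    rw [← of_star, ← of_mul, norm_of, norm_of]
    exact CStarRing.norm_mul_self_le a

instance : IsScalarTower ℂ (Stab A) (Stab A) where
  smul_assoc r x y := ind₂ x y (isClosed_eq
      ((continuous_const_smul r).comp continuous_fst |>.mul continuous_snd)
      ((continuous_const_smul r).comp (continuous_fst.mul continuous_snd))) fun a b => by
    change r • of a * of b = r • (of a * of b)
    rw [← of_smul r a, ← of_mul (r • a) b, ← of_mul a b, ← of_smul r (a * b), smul_mul_assoc]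

instance : SMulCommClass ℂ (Stab A) (Stab A) where
  smul_comm r x y := ind₂ x y (isClosed_eq
      ((continuous_const_smul r).comp (continuous_fst.mul continuous_snd))
      (continuous_fst.mul ((continuous_const_smul r).comp continuous_snd))) fun a b => by
    change r • (of a * of b) = of a * (r • of b)
    rw [← of_smul r b, ← of_mul a (r • b), ← of_mul a b, ← of_smul r (a * b), mul_smul_comm]

instance : StarModule ℂ (Stab A) where
  star_smul r x := ind x (isClosed_eq (continuous_star.comp (continuous_const_smul r))
      ((continuous_const_smul (star r)).comp continuous_star)) fun a => by
    rw [← of_smul r a, ← of_star (r • a), ← of_star a, ← of_smul (star r) (star a), star_smul]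

instance : NonUnitalCStarAlgebra (Stab A) where

/-- The inclusion of `M_∞(A)` in `𝒦 ⊗ A`. -/
def ofHom : MatInf A →⋆ₙₐ[ℂ] Stab A where
  toFun := of
  map_smul' := of_smul
  map_zero' := of_zero
  map_add' := of_add
  map_mul' := of_mul
  map_star' := of_star

end Stab

namespace MatInf

variable {A B C : Type*} [NonUnitalCStarAlgebra A] [NonUnitalCStarAlgebra B]
  [NonUnitalCStarAlgebra C]

lemma norm_hom_le (φ : MatInf A →⋆ₙₐ[ℂ] MatInf B) (a : MatInf A) : ‖φ a‖ ≤ ‖a‖ := by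
  obtain ⟨n, ha⟩ := a.exists_bdd
  have h := NonUnitalStarAlgHom.norm_apply_le ((Stab.ofHom.comp φ).comp (pad n)) (trunc n a)
  change ‖Stab.of (φ (pad n (trunc n a)))‖ ≤ _ at h
  rwa [pad_trunc ha, Stab.norm_of, ← norm_eq ha] at h

lemma continuous_hom (φ : MatInf A →⋆ₙₐ[ℂ] MatInf B) : Continuous φ :=
  AddMonoidHomClass.continuous_of_bound φ 1 (by simpa using norm_hom_le φ)

lemma uniformContinuous_hom (φ : MatInf A →⋆ₙₐ[ℂ] MatInf B) : UniformContinuous φ :=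
  uniformContinuous_addMonoidHom_of_continuous (continuous_hom φ)

/-- The entrywise application of a ⋆-homomorphism `A → B`. -/
def map (ψ : A →⋆ₙₐ[ℂ] B) : MatInf A →⋆ₙₐ[ℂ] MatInf B where
  toFun a := ⟨fun i j => ψ (a.entry i j), by
    obtain ⟨n, ha⟩ := a.exists_bdd
    exact ⟨n, fun i j h => by rw [ha i j h, map_zero]⟩⟩
  map_smul' r a := by ext i j; simp
  map_zero' := by ext i j; simp
  map_add' a b := by ext i j; simp
  map_mul' a b := by
    obtain ⟨n, ha⟩ := a.exists_bdd
    ext i j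
    rw [mul_apply_of_bdd (n := n) (Or.inl fun i j h => by simp [ha i j h])]
    simp [mul_apply_of_bdd (Or.inl ha)]
  map_star' a := by ext i j; simp [map_star]

@[simp] lemma map_apply (ψ : A →⋆ₙₐ[ℂ] B) (a : MatInf A) (i j : ℕ) :
    (map ψ a).entry i j = ψ (a.entry i j) := rfl

end MatInf

namespace Stab

variable {A B : Type*} [NonUnitalCStarAlgebra A] [NonUnitalCStarAlgebra B]

/-- The ⋆-homomorphism `id ⊗ ψ : 𝒦 ⊗ A → 𝒦 ⊗ B` induced by `ψ : A → B`. -/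
def map (ψ : A →⋆ₙₐ[ℂ] B) : Stab A →⋆ₙₐ[ℂ] Stab B :=
  let f : Stab A → Stab B := UniformSpace.Completion.map (MatInf.map ψ)
  have hf (a : MatInf A) : f (of a) = of (MatInf.map ψ a) :=
    UniformSpace.Completion.map_coe (MatInf.uniformContinuous_hom _) a
  have hc : Continuous f := UniformSpace.Completion.continuous_map
  { toFun := f
    map_smul' := fun r x => ind x (isClosed_eq (hc.comp (continuous_const_smul r))
        ((continuous_const_smul r).comp hc)) fun a => by
      change f (r • of a) = r • f (of a)
      rw [← of_smul r a, hf, hf, map_smul, of_smul]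
    map_zero' := by rw [← of_zero, hf, map_zero, of_zero]
    map_add' := fun x y => ind₂ x y (isClosed_eq (by fun_prop) (by fun_prop)) fun a b => by
      rw [← of_add, hf, hf, hf, map_add, of_add]
    map_mul' := fun x y => ind₂ x y (isClosed_eq (by fun_prop) (by fun_prop)) fun a b => by
      rw [← of_mul, hf, hf, hf, map_mul, of_mul]
    map_star' := fun x => ind x (isClosed_eq (hc.comp continuous_star) (continuous_star.comp hc))
        fun a => by rw [← of_star, hf, hf, map_star, of_star] }

end Stab

/-! ### Cuntz comparison -/

namespace MatInf

variable {A B : Type*} [NonUnitalCStarAlgebra A] [NonUnitalCStarAlgebra B]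

/-- The positive elements of `M_∞(A)`: those that are positive in some `M_n(A)`. -/
def IsPos (a : MatInf A) : Prop :=
  ∃ (n : ℕ) (x : CStarMatrix (Fin n) (Fin n) A), 0 ≤ x ∧ pad n x = a

/-- Cuntz subequivalence: `a` is a norm limit of elements `c_n b c_n^*` with `c_n ∈ M_∞(A)`. -/
def CuntzSubeq (a b : MatInf A) : Prop :=
  ∃ c : ℕ → MatInf A, Tendsto (fun n => c n * b * star (c n)) atTop (𝓝 a)

lemma exists_eq_star_mul_self {M : Type*} [NonUnitalCStarAlgebra M] {x : M} (hx : 0 ≤ x) :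
    ∃ y, x = star y * y := CStarAlgebra.nonneg_iff_eq_star_mul_self.mp hx

lemma isPos_iff {a : MatInf A} : IsPos a ↔ ∃ y, a = star y * y := by
  constructor
  · rintro ⟨n, x, hx, rfl⟩
    obtain ⟨y, rfl⟩ := exists_eq_star_mul_self hx
    exact ⟨pad n y, by rw [map_mul, map_star]⟩
  · rintro ⟨y, rfl⟩
    obtain ⟨n, hy⟩ := y.exists_bdd
    exact ⟨n, star (trunc n y) * trunc n y, star_mul_self_nonneg _, by
      rw [map_mul, map_star, pad_trunc hy]⟩

lemma IsPos.hom {a : MatInf A} (h : IsPos a) (φ : MatInf A →⋆ₙₐ[ℂ] MatInf B) : IsPos (φ a) := by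
  obtain ⟨y, rfl⟩ := isPos_iff.mp h
  exact isPos_iff.mpr ⟨φ y, by rw [map_mul, map_star]⟩

lemma IsPos.add {a b : MatInf A} (ha : IsPos a) (hb : IsPos b) : IsPos (a + b) := by
  obtain ⟨x, rfl⟩ := isPos_iff.mp ha
  obtain ⟨y, rfl⟩ := isPos_iff.mp hb
  obtain ⟨n, hx, hy⟩ := exists_bdd₂ x y
  refine ⟨n, star (trunc n x) * trunc n x + star (trunc n y) * trunc n y,
    add_nonneg (star_mul_self_nonneg _) (star_mul_self_nonneg _), ?_⟩
  simp only [map_add, map_mul, map_star, pad_trunc hx, pad_trunc hy]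

lemma isPos_zero : IsPos (0 : MatInf A) := isPos_iff.mpr ⟨0, by simp⟩

lemma cuntzSubeq_iff {a b : MatInf A} :
    CuntzSubeq a b ↔ ∀ ε > 0, ∃ c : MatInf A, ‖c * b * star c - a‖ < ε := by
  constructor
  · rintro ⟨c, hc⟩ ε hε
    obtain ⟨n, hn⟩ := ((Metric.tendsto_nhds.mp hc) ε hε).exists
    exact ⟨c n, by rwa [dist_eq_norm] at hn⟩
  · intro h
    choose c hc using fun n : ℕ => h (1 / ((n : ℝ) + 1)) (by positivity)
    refine ⟨c, ?_⟩
    rw [tendsto_iff_norm_sub_tendsto_zero]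
    exact squeeze_zero (fun _ => norm_nonneg _) (fun n => (hc n).le)
      tendsto_one_div_add_atTop_nhds_zero_nat

lemma exists_approx_unit (a : MatInf A) {ε : ℝ} (hε : 0 < ε) :
    ∃ e : MatInf A, ‖e * a * star e - a‖ < ε := by
  obtain ⟨n, ha⟩ := a.exists_bdd
  let M := CStarMatrix (Fin n) (Fin n) A
  have hu := CStarAlgebra.increasingApproximateUnit M
  have h1 := hu.tendsto_mul_left (trunc n a)
  have h2 := hu.tendsto_mul_right (trunc n a)
  have hb := hu.eventually_norm
  have hs := hu.eventually_star_eq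
  have hn := hu.neBot
  obtain ⟨e, ⟨⟨h1, h2⟩, hb⟩, hs⟩ := (((Metric.tendsto_nhds.mp h1 (ε / 2) (half_pos hε)).and
    (Metric.tendsto_nhds.mp h2 (ε / 2) (half_pos hε))).and hb |>.and hs).exists
  rw [dist_eq_norm] at h1 h2
  refine ⟨pad n e, ?_⟩
  have key : ‖e * trunc n a * star e - trunc n a‖ < ε := by
    rw [hs]
    calc ‖e * trunc n a * e - trunc n a‖
        = ‖(e * trunc n a - trunc n a) * e + (trunc n a * e - trunc n a)‖ := by
          congr 1; noncomm_ring
      _ ≤ ‖e * trunc n a - trunc n a‖ * ‖e‖ + ‖trunc n a * e - trunc n a‖ :=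
          (norm_add_le _ _).trans (by gcongr; exact norm_mul_le _ _)
      _ ≤ ‖e * trunc n a - trunc n a‖ * 1 + ‖trunc n a * e - trunc n a‖ := by gcongr
      _ < ε := by linarith
  rw [← norm_pad, map_sub, map_mul, map_mul, map_star, pad_trunc ha] at key
  exact key

lemma CuntzSubeq.refl (a : MatInf A) : CuntzSubeq a a :=
  cuntzSubeq_iff.mpr fun _ hε => exists_approx_unit a hε

lemma CuntzSubeq.trans {a b c : MatInf A} (hab : CuntzSubeq a b) (hbc : CuntzSubeq b c) :
    CuntzSubeq a c := by
  rw [cuntzSubeq_iff] at *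
  intro ε hε
  obtain ⟨x, hx⟩ := hab (ε / 2) (half_pos hε)
  obtain ⟨y, hy⟩ := hbc (ε / 2 / (‖x‖ ^ 2 + 1)) (by positivity)
  refine ⟨x * y, ?_⟩
  calc ‖x * y * c * star (x * y) - a‖
      = ‖x * (y * c * star y - b) * star x + (x * b * star x - a)‖ := by
        rw [star_mul]; congr 1; noncomm_ring
    _ ≤ ‖x‖ * ‖y * c * star y - b‖ * ‖x‖ + ‖x * b * star x - a‖ := by
        refine (norm_add_le _ _).trans ?_
        gcongr
        refine (norm_mul_le _ _).trans ?_
        rw [norm_star]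
        gcongr
        exact norm_mul_le _ _
    _ < ε := by
        rw [lt_div_iff₀ (by positivity)] at hy
        nlinarith [norm_nonneg (y * c * star y - b)]

lemma CuntzSubeq.hom {a b : MatInf A} (h : CuntzSubeq a b) (φ : MatInf A →⋆ₙₐ[ℂ] MatInf B) :
    CuntzSubeq (φ a) (φ b) := by
  obtain ⟨c, hc⟩ := h
  refine ⟨fun n => φ (c n), ?_⟩
  simpa only [Function.comp_def, map_mul, map_star] using! ((continuous_hom φ).tendsto a).comp hc

/-! #### Moving rows and columns -/

/-- The matrix with entry `a i j` at the position `(f i, g j)`, and zeros elsewhere. -/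
def emb (f g : ℕ ↪ ℕ) (a : MatInf A) : MatInf A where
  entry i j := Function.extend f (fun i' => Function.extend g (a.entry i') 0 j) 0 i
  exists_bound := by
    obtain ⟨n, ha⟩ := a.exists_bdd
    refine ⟨∑ k ∈ Finset.range n, (f k + 1) + ∑ k ∈ Finset.range n, (g k + 1), fun i j h => ?_⟩
    by_cases hi : ∃ i', f i' = i
    · obtain ⟨i', rfl⟩ := hi
      rw [f.injective.extend_apply]
      by_cases hj : ∃ j', g j' = j
      · obtain ⟨j', rfl⟩ := hj
        rw [g.injective.extend_apply]
        apply ha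
        by_contra! hc
        have h1 := Finset.single_le_sum (f := fun k => f k + 1) (fun _ _ => Nat.zero_le _)
          (Finset.mem_range.mpr hc.1)
        have h2 := Finset.single_le_sum (f := fun k => g k + 1) (fun _ _ => Nat.zero_le _)
          (Finset.mem_range.mpr hc.2)
        omega
      · rw [Function.extend_apply' _ _ _ hj]; rfl
    · rw [Function.extend_apply' _ _ _ hi]; rfl

variable (f g h : ℕ ↪ ℕ)

@[simp] lemma emb_apply (a : MatInf A) (i j : ℕ) : (emb f g a).entry (f i) (g j) = a.entry i j := by
  simp [emb, f.injective.extend_apply, g.injective.extend_apply]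

lemma emb_left (a : MatInf A) {i : ℕ} (hi : ¬ ∃ i', f i' = i) (j : ℕ) :
    (emb f g a).entry i j = 0 := by
  simp [emb, Function.extend_apply' _ _ _ hi]

lemma emb_right (a : MatInf A) (i : ℕ) {j : ℕ} (hj : ¬ ∃ j', g j' = j) :
    (emb f g a).entry i j = 0 := by
  by_cases hi : ∃ i', f i' = i
  · obtain ⟨i, rfl⟩ := hi
    simp [emb, f.injective.extend_apply, Function.extend_apply' _ _ _ hj]
  · exact emb_left f g a hi j

lemma emb_ext {a x : MatInf A} (h0 : ∀ i j, x.entry (f i) (g j) = a.entry i j)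
    (h1 : ∀ i j, (¬ ∃ i', f i' = i) → x.entry i j = 0)
    (h2 : ∀ i j, (¬ ∃ j', g j' = j) → x.entry i j = 0) : x = emb f g a := by
  ext i j
  by_cases hi : ∃ i', f i' = i
  · by_cases hj : ∃ j', g j' = j
    · obtain ⟨i, rfl⟩ := hi
      obtain ⟨j, rfl⟩ := hj
      rw [h0, emb_apply]
    · rw [h2 _ _ hj, emb_right f g a i hj]
  · rw [h1 _ _ hi, emb_left f g a hi]

lemma emb_mul (a b : MatInf A) : emb f g a * emb g h b = emb f h (a * b) := by
  refine emb_ext f h (fun i j => ?_) (fun i j hi => ?_) (fun i j hj => ?_)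
  · rw [mul_apply, mul_apply]
    trans ∑ᶠ k ∈ Set.range g, (emb f g a).entry (f i) k * (emb g h b).entry k (h j)
    · rw [finsum_mem_def, Set.indicator_eq_self.mpr]
      intro k hk
      by_contra hk'
      exact hk (by simp only [emb_left g h b hk', mul_zero])
    · rw [finsum_mem_range g.injective]
      simp only [emb_apply]
  · simp [mul_apply, emb_left f g a hi]
  · simp [mul_apply, emb_right g h b _ hj]

lemma emb_mul_of_disjoint {f g g' h : ℕ ↪ ℕ} (hd : ∀ i j, g i ≠ g' j) (a b : MatInf A) :
    emb f g a * emb g' h b = 0 := by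
  ext i j
  rw [mul_apply, zero_apply]
  refine finsum_eq_zero_of_forall_eq_zero fun k => ?_
  by_cases hk : ∃ k', g k' = k
  · obtain ⟨k, rfl⟩ := hk
    rw [emb_left g' h b (by rintro ⟨k', hk'⟩; exact hd _ _ hk'.symm), mul_zero]
  · rw [emb_right f g a i hk, zero_mul]

lemma emb_star (a : MatInf A) : star (emb f g a) = emb g f (star a) :=
  emb_ext g f (fun i j => by simp) (fun i j hi => by simp [emb_right f g a j hi])
    (fun i j hj => by simp [emb_left f g a hj])

lemma emb_add (a b : MatInf A) : emb f g (a + b) = emb f g a + emb f g b :=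
  (emb_ext f g (fun i j => by simp) (fun i j hi => by simp [emb_left f g _ hi])
    (fun i j hj => by simp [emb_right f g _ i hj])).symm

lemma emb_smul (r : ℂ) (a : MatInf A) : emb f g (r • a) = r • emb f g a :=
  (emb_ext f g (fun i j => by simp) (fun i j hi => by simp [emb_left f g _ hi])
    (fun i j hj => by simp [emb_right f g _ i hj])).symm

/-- The injective endomorphism of `M_∞(A)` induced by an injection of the index set. -/
def embHom : MatInf A →⋆ₙₐ[ℂ] MatInf A where
  toFun := emb f f
  map_smul' := emb_smul f f
  map_zero' := by simpa using emb_smul f f 0 (0 : MatInf A)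
  map_add' := emb_add f f
  map_mul' a b := (emb_mul f f f a b).symm
  map_star' a := (emb_star f f a).symm

lemma embHom_apply (a : MatInf A) : embHom f a = emb f f a := rfl

lemma emb_emb (f' g' : ℕ ↪ ℕ) (a : MatInf A) :
    emb f' g' (emb f g a) = emb (f.trans f') (g.trans g') a := by
  refine emb_ext _ _ (fun i j => ?_) (fun i j hi => ?_) (fun i j hj => ?_)
  · rw [Function.Embedding.trans_apply, Function.Embedding.trans_apply, emb_apply, emb_apply]
  · by_cases h : ∃ i', f' i' = i
    · obtain ⟨i, rfl⟩ := h
      by_cases h' : ∃ j', g' j' = j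
      · obtain ⟨j, rfl⟩ := h'
        rw [emb_apply, emb_left]
        rintro ⟨k, rfl⟩
        exact hi ⟨k, rfl⟩
      · rw [emb_right _ _ _ _ h']
    · rw [emb_left _ _ _ h]
  · by_cases h : ∃ j', g' j' = j
    · obtain ⟨j, rfl⟩ := h
      by_cases h' : ∃ i', f' i' = i
      · obtain ⟨i, rfl⟩ := h'
        rw [emb_apply, emb_right]
        rintro ⟨k, rfl⟩
        exact hj ⟨k, rfl⟩
      · rw [emb_left _ _ _ h']
    · rw [emb_right _ _ _ _ h]

/-- Moving rows and columns does not change the Cuntz class. -/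
lemma emb_cuntz (a : MatInf A) : CuntzSubeq (emb f f a) (emb g g a) := by
  rw [cuntzSubeq_iff]
  intro ε hε
  obtain ⟨e, he⟩ := exists_approx_unit a hε
  refine ⟨emb f g e, ?_⟩
  rw [emb_mul, emb_star, emb_mul, ← embHom_apply, ← embHom_apply, ← map_sub]
  exact (norm_hom_le _ _).trans_lt he

lemma emb_refl (a : MatInf A) : emb (.refl ℕ) (.refl ℕ) a = a :=
  (emb_ext _ _ (fun _ _ => rfl) (fun i _ hi => (hi ⟨i, rfl⟩).elim)
    (fun _ j hj => (hj ⟨j, rfl⟩).elim)).symm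

lemma cuntz_emb (a : MatInf A) : CuntzSubeq a (emb f f a) := by
  simpa only [emb_refl] using emb_cuntz (.refl ℕ) f a

lemma emb_cuntz' (a : MatInf A) : CuntzSubeq (emb f f a) a := by
  simpa only [emb_refl] using emb_cuntz f (.refl ℕ) a

/-- Cuntz subequivalence of orthogonal sums. -/
lemma cuntz_add {f g f' g' : ℕ ↪ ℕ} (hd' : ∀ i j, f' i ≠ g' j)
    {a a' b b' : MatInf A} (ha : CuntzSubeq a a') (hb : CuntzSubeq b b') :
    CuntzSubeq (emb f f a + emb g g b) (emb f' f' a' + emb g' g' b') := by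
  rw [cuntzSubeq_iff] at *
  intro ε hε
  obtain ⟨c, hc⟩ := ha (ε / 2) (half_pos hε)
  obtain ⟨d, hd⟩ := hb (ε / 2) (half_pos hε)
  refine ⟨emb f f' c + emb g g' d, ?_⟩
  have hd'' : ∀ i j, g' i ≠ f' j := fun i j => (hd' j i).symm
  have e1 : (emb f f' c + emb g g' d) * (emb f' f' a' + emb g' g' b') *
      star (emb f f' c + emb g g' d) =
      emb f f (c * a' * star c) + emb g g (d * b' * star d) := by
    simp only [star_add, emb_star, mul_add, add_mul, emb_mul, emb_mul_of_disjoint hd',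
      emb_mul_of_disjoint hd'', add_zero, zero_add]
  have e2 : emb f f (c * a' * star c) + emb g g (d * b' * star d) - (emb f f a + emb g g b) =
      embHom f (c * a' * star c - a) + embHom g (d * b' * star d - b) := by
    rw [map_sub, map_sub]
    simp only [embHom_apply]
    abel
  rw [e1, e2]
  calc _ ≤ ‖c * a' * star c - a‖ + ‖d * b' * star d - b‖ :=
        (norm_add_le _ _).trans (add_le_add (norm_hom_le _ _) (norm_hom_le _ _))
    _ < ε := by linarith

/-- The block diagonal matrix `a ⊕ b = diag(a, b)`, where the block `a` has size `n × n` for the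
least `n` with `a ∈ M_n(A)`. -/
def blockSum (a b : MatInf A) : MatInf A :=
  a + emb (addRightEmbedding a.size) (addRightEmbedding a.size) b

lemma IsPos.blockSum {a b : MatInf A} (ha : IsPos a) (hb : IsPos b) : IsPos (blockSum a b) :=
  ha.add (hb.hom (embHom _))

/-- The embedding of `ℕ` in itself as the even numbers. -/
def evenEmb : ℕ ↪ ℕ := ⟨fun i => 2 * i, fun i j h => by simpa using h⟩

/-- The embedding of `ℕ` in itself as the odd numbers. -/
def oddEmb : ℕ ↪ ℕ := ⟨fun i => 2 * i + 1, fun i j h => by simpa using h⟩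

lemma evenEmb_ne_oddEmb (i j : ℕ) : evenEmb i ≠ oddEmb j := by
  change 2 * i ≠ 2 * j + 1
  omega

/-- The direct sum with interleaved rows and columns, only used to show that the addition of Cuntz
classes is well defined. -/
def interSum (a b : MatInf A) : MatInf A := emb evenEmb evenEmb a + emb oddEmb oddEmb b

/-- An injection that is `i ↦ 2 i` below `n` and `i + n ↦ 2 i + 1`. -/
def weave (n : ℕ) : ℕ ↪ ℕ :=
  ⟨fun i => if i < n then 2 * i else 2 * (i - n) + 1, fun i j h => by
    simp only at h
    split_ifs at h <;> omega⟩

lemma emb_congr {f g f' g' : ℕ ↪ ℕ} {n : ℕ} {a : MatInf A} (ha : Bdd n a)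
    (hf : ∀ i < n, f i = f' i) (hg : ∀ i < n, g i = g' i) : emb f g a = emb f' g' a := by
  refine emb_ext _ _ (fun i j => ?_) (fun i j hi => ?_) (fun i j hj => ?_)
  · by_cases h : i < n ∧ j < n
    · rw [← hf i h.1, ← hg j h.2, emb_apply]
    · rw [ha i j (by omega)]
      by_cases hi : ∃ i', f i' = f' i
      · obtain ⟨i', hi'⟩ := hi
        by_cases hj : ∃ j', g j' = g' j
        · obtain ⟨j', hj'⟩ := hj
          rw [← hi', ← hj', emb_apply]
          apply ha
          by_contra! hc
          rw [hf i' hc.1] at hi'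
          rw [hg j' hc.2] at hj'
          have := f'.injective hi'
          have := g'.injective hj'
          omega
        · exact emb_right _ _ _ _ hj
      · exact emb_left _ _ _ hi _
  · by_cases h : ∃ i', f i' = i
    · obtain ⟨i', rfl⟩ := h
      by_cases h' : ∃ j', g j' = j
      · obtain ⟨j', rfl⟩ := h'
        rw [emb_apply]
        apply ha
        by_contra! hc
        exact hi ⟨i', (hf i' hc.1).symm⟩
      · exact emb_right _ _ _ _ h'
    · exact emb_left _ _ _ h _
  · by_cases h : ∃ j', g j' = j
    · obtain ⟨j', rfl⟩ := h
      by_cases h' : ∃ i', f i' = i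
      · obtain ⟨i', rfl⟩ := h'
        rw [emb_apply]
        apply ha
        by_contra! hc
        exact hj ⟨j', (hg j' hc.2).symm⟩
      · exact emb_left _ _ _ h' _
    · exact emb_right _ _ _ _ h

lemma emb_weave_blockSum (a b : MatInf A) :
    emb (weave a.size) (weave a.size) (blockSum a b) = interSum a b := by
  have h1 : ∀ i < a.size, weave a.size i = evenEmb i := fun i hi => if_pos hi
  have h2 : (addRightEmbedding a.size).trans (weave a.size) = oddEmb := by
    ext i
    change (if i + a.size < a.size then _ else 2 * (i + a.size - a.size) + 1) = 2 * i + 1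
    rw [if_neg (by omega), Nat.add_sub_cancel]
  rw [blockSum, emb_add, emb_emb, h2, emb_congr a.bdd_size h1 h1, interSum]

lemma blockSum_cuntz_interSum (a b : MatInf A) : CuntzSubeq (blockSum a b) (interSum a b) := by
  rw [← emb_weave_blockSum]
  exact cuntz_emb _ _

lemma interSum_cuntz_blockSum (a b : MatInf A) : CuntzSubeq (interSum a b) (blockSum a b) := by
  rw [← emb_weave_blockSum]
  exact emb_cuntz' _ _

lemma CuntzSubeq.blockSum {a a' b b' : MatInf A} (ha : CuntzSubeq a a') (hb : CuntzSubeq b b') :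
    CuntzSubeq (blockSum a b) (blockSum a' b') :=
  ((blockSum_cuntz_interSum a b).trans (cuntz_add evenEmb_ne_oddEmb ha hb)).trans
    (interSum_cuntz_blockSum a' b')

lemma blockSum_comm_cuntz (a b : MatInf A) : CuntzSubeq (blockSum a b) (blockSum b a) := by
  refine ((blockSum_cuntz_interSum a b).trans ?_).trans (interSum_cuntz_blockSum b a)
  rw [interSum, interSum, add_comm (emb evenEmb evenEmb b)]
  exact cuntz_add (fun i j => (evenEmb_ne_oddEmb j i).symm) (.refl a) (.refl b)

lemma emb_zero (f g : ℕ ↪ ℕ) : emb f g (0 : MatInf A) = 0 := by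
  simpa using emb_smul f g 0 (0 : MatInf A)

lemma zero_blockSum_cuntz (a : MatInf A) :
    CuntzSubeq (MatInf.blockSum 0 a) a ∧ CuntzSubeq a (MatInf.blockSum 0 a) := by
  rw [MatInf.blockSum, zero_add]
  exact ⟨emb_cuntz' _ _, cuntz_emb _ _⟩

/-- The injection `4 i ↦ 2 i`, `4 i + 2 ↦ 4 i + 1`, `2 i + 1 ↦ 4 i + 3`. -/
def shuffle : ℕ ↪ ℕ :=
  ⟨fun i => if i % 4 = 0 then i / 2 else if i % 4 = 2 then i - 1 else 2 * i + 1,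
    fun i j h => by
      simp only at h
      split_ifs at h <;> omega⟩

lemma interSum_assoc (a b c : MatInf A) :
    emb shuffle shuffle (interSum (interSum a b) c) = interSum a (interSum b c) := by
  have h1 : (evenEmb.trans evenEmb).trans shuffle = evenEmb := by
    ext i
    change (if 2 * (2 * i) % 4 = 0 then 2 * (2 * i) / 2 else _) = 2 * i
    rw [if_pos (by omega)]
    omega
  have h2 : (oddEmb.trans evenEmb).trans shuffle = evenEmb.trans oddEmb := by
    ext i
    change (if 2 * (2 * i + 1) % 4 = 0 then _ else if 2 * (2 * i + 1) % 4 = 2 then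
      2 * (2 * i + 1) - 1 else _) = 2 * (2 * i) + 1
    rw [if_neg (by omega), if_pos (by omega)]
    omega
  have h3 : oddEmb.trans shuffle = oddEmb.trans oddEmb := by
    ext i
    change (if (2 * i + 1) % 4 = 0 then _ else if (2 * i + 1) % 4 = 2 then _ else
      2 * (2 * i + 1) + 1) = 2 * (2 * i + 1) + 1
    rw [if_neg (by omega), if_neg (by omega)]
  simp only [interSum, emb_add, emb_emb, h1, h2, h3, add_assoc]

lemma CuntzSubeq.interSum {a a' b b' : MatInf A} (ha : CuntzSubeq a a') (hb : CuntzSubeq b b') :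
    CuntzSubeq (interSum a b) (interSum a' b') := cuntz_add evenEmb_ne_oddEmb ha hb

lemma blockSum_assoc_cuntz (a b c : MatInf A) :
    CuntzSubeq ((a.blockSum b).blockSum c) (a.blockSum (b.blockSum c)) ∧
      CuntzSubeq (a.blockSum (b.blockSum c)) ((a.blockSum b).blockSum c) := by
  constructor
  · refine (((blockSum_cuntz_interSum _ c).trans
      ((blockSum_cuntz_interSum a b).interSum (.refl c))).trans ?_).trans
      (((CuntzSubeq.refl a).interSum (interSum_cuntz_blockSum b c)).trans
        (interSum_cuntz_blockSum a _))
    rw [← interSum_assoc]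
    exact cuntz_emb _ _
  · refine (((blockSum_cuntz_interSum a _).trans
      ((CuntzSubeq.refl a).interSum (blockSum_cuntz_interSum b c))).trans ?_).trans
      (((interSum_cuntz_blockSum a b).interSum (.refl c)).trans
        (interSum_cuntz_blockSum _ c))
    rw [← interSum_assoc]
    exact emb_cuntz' _ _

lemma map_emb (ψ : A →⋆ₙₐ[ℂ] B) (f g : ℕ ↪ ℕ) (a : MatInf A) :
    map ψ (emb f g a) = emb f g (map ψ a) :=
  emb_ext f g (fun i j => by simp) (fun i j hi => by simp [emb_left f g _ hi])
    (fun i j hj => by simp [emb_right f g _ i hj])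

lemma map_interSum (ψ : A →⋆ₙₐ[ℂ] B) (a b : MatInf A) :
    map ψ (interSum a b) = interSum (map ψ a) (map ψ b) := by
  simp only [interSum, map_add, map_emb]

lemma map_blockSum_cuntz (ψ : A →⋆ₙₐ[ℂ] B) (a b : MatInf A) :
    CuntzSubeq (map ψ (a.blockSum b)) ((map ψ a).blockSum (map ψ b)) ∧
      CuntzSubeq ((map ψ a).blockSum (map ψ b)) (map ψ (a.blockSum b)) := by
  constructor
  · refine ((blockSum_cuntz_interSum a b).hom (map ψ)).trans ?_
    rw [map_interSum]
    exact interSum_cuntz_blockSum _ _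
  · refine (blockSum_cuntz_interSum _ _).trans ?_
    rw [← map_interSum]
    exact (interSum_cuntz_blockSum a b).hom (map ψ)

end MatInf

/-! ### The Cuntz semigroups -/

/-- The set `M_∞(A)_+` of positive elements of `M_∞(A)`. -/
def PosMatInf (A : Type*) [NonUnitalCStarAlgebra A] : Type _ := {a : MatInf A // a.IsPos}

/-- The preorder on `M_∞(A)_+` given by Cuntz subequivalence. -/
instance (A : Type*) [NonUnitalCStarAlgebra A] : Preorder (PosMatInf A) where
  le a b := a.1.CuntzSubeq b.1
  le_refl a := .refl a.1
  le_trans _ _ _ h h' := h.trans h'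

/-- The Cuntz semigroup `W(A)`: the quotient of `M_∞(A)_+` by Cuntz equivalence (that is, Cuntz
subequivalence in both directions), ordered by Cuntz subequivalence. -/
def W (A : Type*) [NonUnitalCStarAlgebra A] : Type _ := Antisymmetrization (PosMatInf A) (· ≤ ·)

/-- The Cuntz semigroup `Cu(A) = W(𝒦 ⊗ A)`. -/
abbrev Cu (A : Type*) [NonUnitalCStarAlgebra A] : Type _ := W (Stab A)

namespace W

variable {A B : Type*} [NonUnitalCStarAlgebra A] [NonUnitalCStarAlgebra B]

instance : PartialOrder (W A) :=
  inferInstanceAs (PartialOrder (Antisymmetrization (PosMatInf A) (· ≤ ·)))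

/-- The Cuntz class of a positive element of `M_∞(A)`. -/
def mk (a : MatInf A) (ha : a.IsPos) : W A :=
  toAntisymmetrization (α := PosMatInf A) (· ≤ ·) ⟨a, ha⟩

lemma mk_le_mk {a b : MatInf A} {ha : a.IsPos} {hb : b.IsPos} :
    mk a ha ≤ mk b hb ↔ a.CuntzSubeq b :=
  toAntisymmetrization_le_toAntisymmetrization_iff

@[elab_as_elim] lemma ind {p : W A → Prop} (x : W A) (h : ∀ a ha, p (mk a ha)) : p x :=
  Antisymmetrization.ind _ (fun a => h a.1 a.2) x

instance : Zero (W A) := ⟨mk 0 MatInf.isPos_zero⟩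

/-- Addition of Cuntz classes: `⟨a⟩ + ⟨b⟩ = ⟨a ⊕ b⟩`. -/
instance : Add (W A) :=
  ⟨Quotient.map₂ (fun a b : PosMatInf A => (⟨a.1.blockSum b.1, a.2.blockSum b.2⟩ : PosMatInf A))
    fun _ _ h _ _ h' => ⟨MatInf.CuntzSubeq.blockSum h.1 h'.1, MatInf.CuntzSubeq.blockSum h.2 h'.2⟩⟩

lemma mk_add_mk {a b : MatInf A} (ha : a.IsPos) (hb : b.IsPos) :
    mk a ha + mk b hb = mk (a.blockSum b) (ha.blockSum hb) := rfl

lemma mk_zero : mk (0 : MatInf A) MatInf.isPos_zero = 0 := rfl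

lemma add_comm' (x y : W A) : x + y = y + x :=
  ind x fun a _ => ind y fun b _ => le_antisymm
    (mk_le_mk.mpr (a.blockSum_comm_cuntz b)) (mk_le_mk.mpr (b.blockSum_comm_cuntz a))

instance : AddCommMonoid (W A) where
  add_comm := add_comm'
  zero_add x := ind x fun a ha => le_antisymm
    (mk_le_mk.mpr (a.zero_blockSum_cuntz).1) (mk_le_mk.mpr (a.zero_blockSum_cuntz).2)
  add_zero x := by
    rw [add_comm']
    exact ind x fun a ha => le_antisymm
      (mk_le_mk.mpr (a.zero_blockSum_cuntz).1) (mk_le_mk.mpr (a.zero_blockSum_cuntz).2)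
  add_assoc x y z := by
    refine ind x fun a ha => ind y fun b hb => ind z fun c hc => le_antisymm ?_ ?_
    · exact mk_le_mk.mpr (MatInf.blockSum_assoc_cuntz a b c).1
    · exact mk_le_mk.mpr (MatInf.blockSum_assoc_cuntz a b c).2
  nsmul := nsmulRec

instance : IsOrderedAddMonoid (W A) where
  add_le_add_left x y h z := by
    induction x using ind with | h a ha => ?_
    induction y using ind with | h b hb => ?_
    induction z using ind with | h c hc => ?_
    exact mk_le_mk.mpr ((mk_le_mk.mp h).blockSum (.refl c))

/-- The homomorphism `W(ψ) : W(A) → W(B)`, `⟨a⟩ ↦ ⟨ψ(a)⟩`, induced by `ψ : A → B`. -/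
def map (ψ : A →⋆ₙₐ[ℂ] B) : W A →+ W B where
  toFun := Quotient.map
    (fun a : PosMatInf A => (⟨MatInf.map ψ a.1, a.2.hom _⟩ : PosMatInf B))
    fun _ _ h => ⟨MatInf.CuntzSubeq.hom h.1 _, MatInf.CuntzSubeq.hom h.2 _⟩
  map_zero' := by
    change mk (MatInf.map ψ 0) _ = mk 0 _
    congr 1
    exact map_zero _
  map_add' x y := ind x fun a ha => ind y fun b hb => by
    change mk (MatInf.map ψ (a.blockSum b)) _ =
      mk ((MatInf.map ψ a).blockSum (MatInf.map ψ b)) _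
    exact le_antisymm (mk_le_mk.mpr (MatInf.map_blockSum_cuntz ψ a b).1)
      (mk_le_mk.mpr (MatInf.map_blockSum_cuntz ψ a b).2)

lemma map_mk (ψ : A →⋆ₙₐ[ℂ] B) {a : MatInf A} (ha : a.IsPos) :
    map ψ (mk a ha) = mk (MatInf.map ψ a) (ha.hom _) := rfl

end W

/-- The homomorphism `Cu(ψ) : Cu(A) → Cu(B)` induced by `ψ : A → B`. -/
def Cu.map {A B : Type*} [NonUnitalCStarAlgebra A] [NonUnitalCStarAlgebra B] (ψ : A →⋆ₙₐ[ℂ] B) :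
    Cu A →+ Cu B := W.map (Stab.map ψ)

/-- A homomorphism of ordered semigroups is an ordered semigroup isomorphism onto its range. -/
def IsOrderIsoOntoRange {M N : Type*} [AddCommMonoid M] [PartialOrder M] [AddCommMonoid N]
    [PartialOrder N] (f : M →+ N) : Prop :=
  ∃ e : M ≃+o AddMonoidHom.mrange f, ∀ x, (e x : N) = f x

/-! ### Actions and crossed products -/

section CrossedProduct

set_option linter.unusedSectionVars false

variable {G A : Type*} [Group G] [Fintype G] [NonUnitalCStarAlgebra A]

/-- The crossed product `C*(G, A, α)` of a C⋆-algebra `A` by an action `α : G → Aut(A)` of a finite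
group: the ⋆-algebra of all functions `a : G → A`, written `∑ a_g u_g`, with the twisted
convolution and the norm of the regular representation. As `G` is finite, this ⋆-algebra is complete
in that norm, which is therefore its only C⋆-norm, and every covariant representation extends to it
contractively: the full and the reduced crossed product coincide. -/
structure CrossedProduct (α : G →* (A ≃⋆ₐ[ℂ] A)) where
  /-- The coefficients `a_g` of `∑ a_g u_g`. -/
  coeff : G → A

namespace CrossedProduct

variable {α : G →* (A ≃⋆ₐ[ℂ] A)}

lemma coeff_injective : Function.Injective (coeff : CrossedProduct α → G → A) := by
  rintro ⟨a⟩ ⟨b⟩ h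
  cases h
  rfl

@[ext] lemma ext {a b : CrossedProduct α} (h : ∀ g, a.coeff g = b.coeff g) : a = b :=
  coeff_injective (funext h)

instance : Zero (CrossedProduct α) := ⟨⟨0⟩⟩
instance : Add (CrossedProduct α) := ⟨fun a b => ⟨a.coeff + b.coeff⟩⟩
instance : Neg (CrossedProduct α) := ⟨fun a => ⟨-a.coeff⟩⟩
instance : Sub (CrossedProduct α) := ⟨fun a b => ⟨a.coeff - b.coeff⟩⟩
instance {R : Type*} [SMul R A] : SMul R (CrossedProduct α) := ⟨fun r a => ⟨r • a.coeff⟩⟩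

@[simp] lemma zero_coeff (g : G) : (0 : CrossedProduct α).coeff g = 0 := rfl
@[simp] lemma add_coeff (a b : CrossedProduct α) (g : G) :
    (a + b).coeff g = a.coeff g + b.coeff g := rfl
@[simp] lemma smul_coeff {R : Type*} [SMul R A] (r : R) (a : CrossedProduct α) (g : G) :
    (r • a).coeff g = r • a.coeff g := rfl

instance : AddCommGroup (CrossedProduct α) :=
  Function.Injective.addCommGroup coeff coeff_injective rfl
    (fun _ _ => rfl) (fun _ => rfl) (fun _ _ => rfl) (fun _ _ => rfl) (fun _ _ => rfl)

instance : Module ℂ (CrossedProduct α) where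
  one_smul a := by ext; simp
  mul_smul r s a := by ext; simp [mul_smul]
  smul_zero r := by ext; simp
  smul_add r a b := by ext; simp
  add_smul r s a := by ext; simp [add_smul]
  zero_smul a := by ext; simp

/-- The product determined by `(a u_g) (b u_h) = a α_g(b) u_{gh}`. -/
instance : Mul (CrossedProduct α) :=
  ⟨fun a b => ⟨fun g => ∑ h, a.coeff h * α h (b.coeff (h⁻¹ * g))⟩⟩

lemma mul_coeff (a b : CrossedProduct α) (g : G) :
    (a * b).coeff g = ∑ h, a.coeff h * α h (b.coeff (h⁻¹ * g)) := rfl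

/-- The adjoint determined by `(a u_g)^* = α_{g⁻¹}(a^*) u_{g⁻¹}`. -/
instance : Star (CrossedProduct α) := ⟨fun a => ⟨fun g => α g (star (a.coeff g⁻¹))⟩⟩

lemma star_coeff (a : CrossedProduct α) (g : G) :
    (star a).coeff g = α g (star (a.coeff g⁻¹)) := rfl

/-- The regular representation of the crossed product by matrices over `A` indexed by `G`. -/
def reg (a : CrossedProduct α) : CStarMatrix G G A :=
  CStarMatrix.ofMatrix fun g h => α g⁻¹ (a.coeff (g * h⁻¹))

lemma reg_apply (a : CrossedProduct α) (g h : G) : reg a g h = α g⁻¹ (a.coeff (g * h⁻¹)) := rfl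

lemma reg_injective : Function.Injective (reg : CrossedProduct α → CStarMatrix G G A) := by
  intro a b hab
  ext g
  have := congrFun (congrFun hab g) 1
  rw [reg_apply, reg_apply] at this
  simpa using this

lemma reg_add (a b : CrossedProduct α) : reg (a + b) = reg a + reg b := by
  ext g h
  simp [reg_apply]

lemma reg_zero : reg (0 : CrossedProduct α) = 0 := by
  ext g h
  simp [reg_apply]

lemma reg_smul (r : ℂ) (a : CrossedProduct α) : reg (r • a) = r • reg a := by
  ext g h
  simp [reg_apply]

lemma action_action (g h : G) (x : A) : α g (α h x) = α (g * h) x := by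
  rw [map_mul]
  rfl

lemma reg_mul (a b : CrossedProduct α) : reg (a * b) = reg a * reg b := by
  ext g k
  rw [reg_apply, mul_coeff, map_sum, CStarMatrix.mul_apply]
  refine Fintype.sum_equiv ((Equiv.inv G).trans (Equiv.mulRight g)) _ _ fun t => ?_
  change α g⁻¹ (a.coeff t * α t (b.coeff (t⁻¹ * (g * k⁻¹)))) =
    α g⁻¹ (a.coeff (g * (t⁻¹ * g)⁻¹)) * α (t⁻¹ * g)⁻¹ (b.coeff (t⁻¹ * g * k⁻¹))
  rw [map_mul, action_action, mul_inv_rev, inv_inv, mul_inv_cancel_left, mul_assoc t⁻¹]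

lemma reg_star (a : CrossedProduct α) : reg (star a) = star (reg a) := by
  ext g h
  rw [reg_apply, star_coeff, CStarMatrix.star_apply, reg_apply, action_action, ← map_star]
  simp

instance : NonUnitalRing (CrossedProduct α) where
  __ := (inferInstance : AddCommGroup (CrossedProduct α))
  zero_mul a := reg_injective (by rw [reg_mul, reg_zero, zero_mul])
  mul_zero a := reg_injective (by rw [reg_mul, reg_zero, mul_zero])
  left_distrib a b c := reg_injective (by simp only [reg_mul, reg_add, mul_add])
  right_distrib a b c := reg_injective (by simp only [reg_mul, reg_add, add_mul])
  mul_assoc a b c := reg_injective (by simp only [reg_mul, mul_assoc])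

instance : StarRing (CrossedProduct α) where
  star_involutive a := reg_injective (by simp only [reg_star, star_star])
  star_mul a b := reg_injective (by simp only [reg_star, reg_mul, star_mul])
  star_add a b := reg_injective (by simp only [reg_star, reg_add, star_add])

instance : Norm (CrossedProduct α) := ⟨fun a => ‖reg a‖⟩

lemma norm_def (a : CrossedProduct α) : ‖a‖ = ‖reg a‖ := rfl

lemma normCore : NormedSpace.Core ℂ (CrossedProduct α) where
  norm_nonneg a := norm_nonneg (reg a)
  norm_smul r a := by rw [norm_def, norm_def, reg_smul, norm_smul]
  norm_triangle a b := by
    rw [norm_def, norm_def, norm_def, reg_add]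
    exact norm_add_le _ _
  norm_eq_zero_iff a := by
    rw [norm_def, norm_eq_zero, ← reg_zero (α := α)]
    exact reg_injective.eq_iff

instance : NormedAddCommGroup (CrossedProduct α) := NormedAddCommGroup.ofCore normCore

instance : NormedSpace ℂ (CrossedProduct α) := NormedSpace.ofCore normCore

instance : NonUnitalNormedRing (CrossedProduct α) where
  __ := (inferInstance : NonUnitalRing (CrossedProduct α))
  __ := (inferInstance : NormedAddCommGroup (CrossedProduct α))
  norm_mul_le a b := by
    rw [norm_def, norm_def, norm_def, reg_mul]
    exact norm_mul_le _ _

lemma isometry_reg : Isometry (reg : CrossedProduct α → CStarMatrix G G A) := by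
  have h : Isometry (AddMonoidHom.mk' reg reg_add : CrossedProduct α →+ CStarMatrix G G A) :=
    AddMonoidHomClass.isometry_of_norm _ fun a => rfl
  exact h

lemma continuous_action (g : G) : Continuous (α g) := (StarAlgEquiv.isometry (α g)).continuous

lemma range_reg : Set.range (reg : CrossedProduct α → CStarMatrix G G A) =
    {x | ∀ g h, x g h = α g⁻¹ (α (g * h⁻¹) (x (g * h⁻¹) 1))} := by
  ext x
  constructor
  · rintro ⟨a, rfl⟩ g h
    rw [reg_apply, reg_apply, action_action, action_action]
    simp
  · intro hx
    refine ⟨⟨fun g => α g (x g 1)⟩, ?_⟩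
    ext g h
    rw [reg_apply, hx g h]

instance : CompleteSpace (CrossedProduct α) := by
  rw [completeSpace_iff_isComplete_range isometry_reg.isUniformInducing, range_reg]
  refine IsClosed.isComplete ?_
  simp only [Set.ofPred_forall]
  have hc (g h : G) : Continuous fun x : CStarMatrix G G A => x g h :=
    (continuous_apply h).comp (continuous_apply g)
  exact isClosed_iInter fun g => isClosed_iInter fun h =>
    isClosed_eq (hc g h) ((continuous_action _).comp ((continuous_action _).comp (hc _ _)))

instance : NonUnitalCStarAlgebra (CrossedProduct α) where
  norm_mul_self_le a := by
    rw [norm_def, norm_def, reg_mul, reg_star]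
    exact CStarRing.norm_mul_self_le _
  smul_assoc r a b := reg_injective (by
    simp only [smul_eq_mul, reg_smul, reg_mul, smul_mul_assoc])
  smul_comm r a b := reg_injective (by
    simp only [smul_eq_mul, reg_smul, reg_mul, mul_smul_comm])
  star_smul r a := reg_injective (by simp only [reg_smul, reg_star, star_smul])

open Classical in
/-- The inclusion `ι : A → C*(G, A, α)`, `a ↦ a u_1`. -/
def incl (α : G →* (A ≃⋆ₐ[ℂ] A)) : A →⋆ₙₐ[ℂ] CrossedProduct α where
  toFun a := ⟨Pi.single 1 a⟩
  map_smul' r a := by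
    ext g
    by_cases hg : g = 1 <;> simp [hg]
  map_zero' := by ext g; simp
  map_add' a b := by ext g; simp [Pi.single_add]
  map_mul' a b := by
    ext g
    rw [mul_coeff, Finset.sum_eq_single 1]
    · by_cases hg : g = 1 <;> simp [hg]
    · intro h _ hh
      simp [Pi.single_apply, hh]
    · simp
  map_star' a := by
    ext g
    rw [star_coeff]
    by_cases hg : g = 1 <;> simp [hg]

end CrossedProduct

end CrossedProduct

/-- An action `α : G → Aut(A)` of a finite group on a unital C⋆-algebra is strictly approximately
inner if for every finite `F ⊆ A` and every `ε > 0` there are unitaries `z_g ∈ A` such that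
`‖α_g(a) - z_g a z_g^*‖ < ε` for `g ∈ G`, `a ∈ F`, and `‖z_g z_h - z_{gh}‖ < ε` for `g, h ∈ G`. -/
def StrictlyApproxInner {G A : Type*} [Group G] [CStarAlgebra A] (α : G →* (A ≃⋆ₐ[ℂ] A)) : Prop :=
  ∀ (F : Finset A) (ε : ℝ), 0 < ε → ∃ z : G → unitary A,
    (∀ g, ∀ a ∈ F, ‖α g a - (z g : A) * a * star (z g : A)‖ < ε) ∧
      ∀ g h, ‖(z g : A) * (z h : A) - (z (g * h) : A)‖ < ε

end

end

/-! A ⋆-homomorphism always preserves Cuntz subequivalence, so the point is that `ι` reflects it: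
`ι(a) ≾ ι(b)` must imply `a ≾ b`. Injectivity then follows from antisymmetry
(`W.isOrderIsoOntoRange_map`).

Strict approximate innerness provides a net of families of unitaries `z_t` with `z_t(g) a z_t(g)^* →
α_g(a)` and `z_t(g) z_t(h) - z_t(gh) → 0`. Replacing `u_g` by `z_t(g)` gives linear maps `φ_t : ∑
a_g u_g ↦ ∑ a_g z_t(g)` from the crossed product to `A`. They are bounded by `|G|` uniformly in `t`,
asymptotically multiplicative and ⋆-preserving, and `φ_t(ι(a)) → a` (`isApproxRetraction_eval`). If
`c ι(b) c^*` is close to `ι(a)`, then `φ_t(c) b φ_t(c)^*` is eventually close to `a`; with `φ_t`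
applied entrywise this works for matrices (`IsApproxRetraction.cuntzSubeq`) and proves (a).

For (b) the same argument is run for `id ⊗ φ_t : 𝒦 ⊗ C*(G, A, α) → 𝒦 ⊗ A`. These maps exist only if
the `φ_t` are bounded on all matrix algebras by one constant. Since `φ_t` is a sum of `|G|`
coefficient maps followed by right multiplications by unitaries, which are isometric on matrices, it
suffices that the coefficient maps are completely contractive (`norm_mapₗ_coeffₗ_le`). That follows
from the identity `E(x x^*) = ∑ x_g x_g^*` for the expectation `E(x) = x_1`, and a repeated squaring
argument which removes the dimension constant from a crude bound on `M_n`. The asymptotic relations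
pass from `M_∞` to its completion by uniform boundedness (`IsApproxRetraction.stab`). -/

namespace MatInf

/-! ### Norms of matrices in terms of their entries -/

section Entries

variable {A B : Type*} [NonUnitalCStarAlgebra A] [NonUnitalCStarAlgebra B]

attribute [local instance] CStarAlgebra.spectralOrder CStarAlgebra.spectralOrderedRing in
lemma norm_entry_le (a : MatInf A) (i j : ℕ) : ‖a.entry i j‖ ≤ ‖a‖ := by
  obtain ⟨n, ha⟩ := a.exists_bdd
  by_cases h : i < n ∧ j < n
  · rw [norm_eq ha]
    exact CStarMatrix.norm_entry_le_norm (M := trunc n a) (i := ⟨i, h.1⟩) (j := ⟨j, h.2⟩)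
  · rw [ha i j (by omega), norm_zero]
    exact norm_nonneg a

/-- The matrix with the entry `x` at the position `(i, j)`, and zeros elsewhere. -/
def single (i j : ℕ) (x : A) : MatInf A where
  entry i' j' := if i' = i ∧ j' = j then x else 0
  exists_bound := ⟨i + j + 1, fun i' j' h => if_neg (by omega)⟩

lemma single_apply (i j : ℕ) (x : A) (i' j' : ℕ) :
    (single i j x).entry i' j' = if i' = i ∧ j' = j then x else 0 := rfl

lemma star_single (i j : ℕ) (x : A) : star (single i j x) = single j i (star x) := by
  ext i' j'
  by_cases h : i' = j ∧ j' = i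
  · simp [single_apply, h]
  · simp [single_apply, h, and_comm (a := j' = i)]

lemma single_mul_single (i j k : ℕ) (x y : A) :
    single i j x * single j k y = single i k (x * y) := by
  ext i' k'
  rw [mul_apply, finsum_eq_single _ j (fun l hl => by simp [single_apply, hl])]
  by_cases h : i' = i <;> by_cases h' : k' = k <;> simp [single_apply, h, h']

/-- The inclusion of `A` in `M_∞(A)` at a diagonal position. -/
def diagHom (j : ℕ) : A →⋆ₙₐ[ℂ] MatInf A where
  toFun := single j j
  map_smul' r x := by ext; simp [single_apply]
  map_zero' := by ext; simp [single_apply]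
  map_add' x y := by ext; simp only [single_apply, add_apply]; split_ifs <;> simp
  map_mul' x y := (single_mul_single j j j x y).symm
  map_star' x := (star_single j j x).symm

/-- At a diagonal position the inclusion is a ⋆-homomorphism, hence contractive; the general case
reduces to it by the C⋆-identity, as `single i j x` has `x^* x` at `(j, j)` as its square. The
detour through `Stab` supplies a complete target. -/
lemma norm_single_le (i j : ℕ) (x : A) : ‖single i j x‖ ≤ ‖x‖ := by
  have h := NonUnitalStarAlgHom.norm_apply_le (Stab.ofHom.comp (diagHom j)) (star x * x)
  change ‖Stab.of (single j j (star x * x))‖ ≤ _ at h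
  rw [Stab.norm_of, ← single_mul_single j i j, ← star_single, CStarRing.norm_star_mul_self,
    CStarRing.norm_star_mul_self] at h
  exact (mul_self_le_mul_self_iff (norm_nonneg _) (norm_nonneg _)).mpr h

lemma sum_apply {ι : Type*} (s : Finset ι) (f : ι → MatInf A) (i j : ℕ) :
    (∑ k ∈ s, f k).entry i j = ∑ k ∈ s, (f k).entry i j := by
  classical
  induction s using Finset.induction_on with
  | empty => simp
  | insert k s hk ih => rw [Finset.sum_insert hk, Finset.sum_insert hk, add_apply, ih]

lemma eq_sum_single {n : ℕ} {a : MatInf A} (ha : Bdd n a) :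
    a = ∑ i ∈ Finset.range n, ∑ j ∈ Finset.range n, single i j (a.entry i j) := by
  ext i j
  simp only [sum_apply, single_apply]
  by_cases h : i < n ∧ j < n
  · rw [Finset.sum_eq_single i, Finset.sum_eq_single j]
    · simp
    · intro k _ hk
      exact if_neg fun h => hk h.2.symm
    · simp [h.2]
    · intro k _ hk
      exact Finset.sum_eq_zero fun l _ => if_neg fun h => hk h.1.symm
    · simp [h.1]
  · rw [ha i j (by omega)]
    refine (Finset.sum_eq_zero fun k hk => Finset.sum_eq_zero fun l hl => if_neg ?_).symm
    simp only [Finset.mem_range] at hk hl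
    omega

lemma norm_le_sum_entry {n : ℕ} {a : MatInf A} (ha : Bdd n a) :
    ‖a‖ ≤ ∑ i ∈ Finset.range n, ∑ j ∈ Finset.range n, ‖a.entry i j‖ := by
  conv_lhs => rw [eq_sum_single ha]
  exact (norm_sum_le _ _).trans (Finset.sum_le_sum fun i _ =>
    (norm_sum_le _ _).trans (Finset.sum_le_sum fun j _ => norm_single_le _ _ _))

lemma norm_le_of_entry_le {n : ℕ} {a : MatInf A} (ha : Bdd n a) {r : ℝ}
    (h : ∀ i j, ‖a.entry i j‖ ≤ r) : ‖a‖ ≤ n * (n * r) :=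
  (norm_le_sum_entry ha).trans <|
    (Finset.sum_le_sum fun i _ => Finset.sum_le_sum fun j _ => h i j).trans (by simp)

/-- The common size `n` is essential: it makes the number of entries that control the norm
independent of `t`. -/
lemma tendsto_zero_of_entry {I : Type*} {l : Filter I} {f : I → MatInf A} {n : ℕ}
    (hf : ∀ t, Bdd n (f t)) (h : ∀ i j, Tendsto (fun t => (f t).entry i j) l (𝓝 0)) :
    Tendsto f l (𝓝 0) := by
  rw [tendsto_zero_iff_norm_tendsto_zero]
  refine squeeze_zero (fun _ => norm_nonneg _) (fun t => norm_le_sum_entry (hf t)) ?_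
  have := tendsto_finsetSum (Finset.range n) fun i _ =>
    tendsto_finsetSum (Finset.range n) fun j _ => (h i j).norm
  simpa using this

/-- The entrywise application of a linear map. -/
def mapₗ (φ : A →ₗ[ℂ] B) : MatInf A →ₗ[ℂ] MatInf B where
  toFun a := ⟨fun i j => φ (a.entry i j), by
    obtain ⟨n, ha⟩ := a.exists_bdd
    exact ⟨n, fun i j h => by rw [ha i j h, map_zero]⟩⟩
  map_add' a b := by ext; simp
  map_smul' r a := by ext; simp

@[simp] lemma mapₗ_apply (φ : A →ₗ[ℂ] B) (a : MatInf A) (i j : ℕ) :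
    (mapₗ φ a).entry i j = φ (a.entry i j) := rfl

lemma Bdd.mapₗ {n : ℕ} {a : MatInf A} (ha : Bdd n a) (φ : A →ₗ[ℂ] B) : Bdd n (mapₗ φ a) :=
  fun i j h => by rw [mapₗ_apply, ha i j h, map_zero]

lemma Bdd.map {n : ℕ} {a : MatInf A} (ha : Bdd n a) (φ : A →⋆ₙₐ[ℂ] B) :
    Bdd n (MatInf.map φ a) :=
  fun i j h => by rw [map_apply, ha i j h, map_zero]

lemma Bdd.sub {n : ℕ} {a b : MatInf A} (ha : Bdd n a) (hb : Bdd n b) : Bdd n (a - b) :=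
  fun i j h => by rw [sub_apply, ha i j h, hb i j h, sub_zero]

end Entries

end MatInf

/-! ### Asymptotic retractions reflect Cuntz subequivalence -/

/-- A bounded family of linear maps `E → B` which is asymptotically a ⋆-homomorphism and
asymptotically a left inverse of `ι`. -/
structure IsApproxRetraction {B E I : Type*} [NonUnitalCStarAlgebra B] [NonUnitalCStarAlgebra E]
    (ι : B →⋆ₙₐ[ℂ] E) (l : Filter I) (φ : I → E →ₗ[ℂ] B) (K : ℝ) : Prop where
  norm_le : ∀ t x, ‖φ t x‖ ≤ K * ‖x‖
  tendsto_mul : ∀ x y, Tendsto (fun t => φ t (x * y) - φ t x * φ t y) l (𝓝 0)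
  tendsto_star : ∀ x, Tendsto (fun t => φ t (star x) - star (φ t x)) l (𝓝 0)
  tendsto_leftInv : ∀ b, Tendsto (fun t => φ t (ι b) - b) l (𝓝 0)

namespace IsApproxRetraction

variable {B E I : Type*} [NonUnitalCStarAlgebra B] [NonUnitalCStarAlgebra E]
  {ι : B →⋆ₙₐ[ℂ] E} {l : Filter I} {φ : I → E →ₗ[ℂ] B} {K : ℝ}

/-- Telescoping: split off `y^*`, move the adjoint out of `φ t`, split `x * ι b`, and replace `φ t
(ι b)` by `b`. Each error is multiplied by factors that stay bounded in `t`. -/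
lemma tendsto_conj (h : IsApproxRetraction ι l φ K) (x y : E) (b : B) :
    Tendsto (fun t => φ t (x * ι b * star y) - φ t x * b * star (φ t y)) l (𝓝 0) := by
  have bdd (x : E) (f : I → B) (hf : Tendsto f l (𝓝 0)) :
      Tendsto (fun t => φ t x * f t) l (𝓝 0) := by
    refine squeeze_zero_norm (a := fun t => K * ‖x‖ * ‖f t‖) (fun t => ?_) ?_
    · exact (norm_mul_le _ _).trans (by gcongr; exact h.norm_le t x)
    · simpa using hf.norm.const_mul (K * ‖x‖)
  have bdd' (y : E) (f : I → B) (hf : Tendsto f l (𝓝 0)) :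
      Tendsto (fun t => f t * star (φ t y)) l (𝓝 0) := by
    have := (bdd y _ (by simpa using hf.star)).star
    simpa using this
  have h1 := h.tendsto_mul (x * ι b) (star y)
  have h2 := bdd (x * ι b) _ (h.tendsto_star y)
  have h3 := bdd' y _ (h.tendsto_mul x (ι b))
  have h4 := bdd' y _ (bdd x _ (h.tendsto_leftInv b))
  have := ((h1.add h2).add h3).add h4
  simp only [add_zero] at this
  refine this.congr fun t => ?_
  noncomm_ring

/-- Apply `φ t` to the entries of an approximate implementation `c` over `E`. Only bounds on entries
enter, so no uniformity over matrix sizes is needed here. -/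
lemma cuntzSubeq [l.NeBot] (h : IsApproxRetraction ι l φ K) {a b : MatInf B}
    (hab : (MatInf.map ι a).CuntzSubeq (MatInf.map ι b)) : a.CuntzSubeq b := by
  rw [MatInf.cuntzSubeq_iff] at *
  intro ε hε
  obtain ⟨n, ha, hb⟩ := MatInf.exists_bdd₂ a b
  -- The size of `c` is unknown before the tolerance is fixed, so the tolerance involves only the
  -- size `n` of `a` and `b`; `n * (n * |K|)` bounds the entrywise `φ t` on the `n × n` corner, and
  -- `+ 1` keeps the divisor positive.
  obtain ⟨c, hc⟩ := hab (ε / 2 / (n * (n * |K|) + 1)) (by positivity)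
  -- Cutting `c` down to its `n × n` corner loses nothing: columns of `c` beyond `n` are killed by
  -- `b`, and rows beyond `n` do not affect the corner in which `a` lives.
  let d (t : I) : MatInf B := MatInf.pad n (MatInf.trunc n (MatInf.mapₗ (φ t) c))
  have hd (t : I) (i j : ℕ) (hi : i < n) (hj : j < n) : (d t).entry i j = φ t (c.entry i j) := by
    simp [d, MatInf.pad_apply, hi, hj]
  have hdn (t : I) : MatInf.Bdd n (d t) := MatInf.bdd_pad _ _
  let w : MatInf E := c * MatInf.map ι b * star c - MatInf.map ι a
  let v (t : I) : MatInf B := MatInf.pad n (MatInf.trunc n (MatInf.mapₗ (φ t) w))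
  have hvn (t : I) : MatInf.Bdd n (v t) := MatInf.bdd_pad _ _
  have hv (t : I) : ‖v t‖ ≤ n * (n * (|K| * ‖w‖)) := by
    refine MatInf.norm_le_of_entry_le (hvn t) fun i j => ?_
    by_cases hij : i < n ∧ j < n
    · simp only [v, MatInf.pad_apply, hij, and_self, dite_true, MatInf.trunc_apply,
        MatInf.mapₗ_apply]
      refine (h.norm_le t _).trans ?_
      gcongr
      · exact le_abs_self K
      · exact MatInf.norm_entry_le w i j
    · rw [hvn t i j (by omega), norm_zero]
      positivity
  have hlim : Tendsto (fun t => v t - (d t * b * star (d t) - a)) l (𝓝 0) := by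
    have hn (t : I) : MatInf.Bdd n (d t * b * star (d t) - a) :=
      (((hdn t).mul hb).mul (hdn t).star).sub ha
    refine MatInf.tendsto_zero_of_entry (fun t => (hvn t).sub (hn t)) fun i j => ?_
    by_cases hij : i < n ∧ j < n
    · have key := (tendsto_finsetSum (Finset.range n) fun k _ =>
        tendsto_finsetSum (Finset.range n) fun m _ =>
          h.tendsto_conj (c.entry i m) (c.entry j k) (b.entry m k)).sub (h.tendsto_leftInv (a.entry i j))
      simp only [Finset.sum_const_zero, sub_zero] at key
      refine key.congr fun t => ?_
      have e1 : w.entry i j = (∑ k ∈ Finset.range n, ∑ m ∈ Finset.range n,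
          c.entry i m * ι (b.entry m k) * star (c.entry j k)) - ι (a.entry i j) := by
        have hcb (k : ℕ) : (c * MatInf.map ι b).entry i k =
            ∑ m ∈ Finset.range n, c.entry i m * ι (b.entry m k) :=
          MatInf.mul_apply_of_bdd (Or.inr (hb.map ι)) i k
        rw [MatInf.sub_apply, MatInf.mul_apply, MatInf.map_apply,
          finsum_eq_sum_of_support_subset (s := Finset.range n)]
        · simp only [hcb, Finset.sum_mul, MatInf.star_apply]
        · intro k hk
          by_contra hkn
          refine hk ?_
          dsimp only
          rw [hcb, Finset.sum_eq_zero, zero_mul]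
          intro m _
          rw [hb m k (Or.inr (by simpa using hkn)), map_zero, mul_zero]
      have e2 : (d t * b * star (d t)).entry i j = ∑ k ∈ Finset.range n, ∑ m ∈ Finset.range n,
          φ t (c.entry i m) * b.entry m k * star (φ t (c.entry j k)) := by
        rw [MatInf.mul_apply_of_bdd (Or.inl ((hdn t).mul hb))]
        refine Finset.sum_congr rfl fun k hk => ?_
        rw [MatInf.mul_apply_of_bdd (Or.inl (hdn t)), Finset.sum_mul]
        refine Finset.sum_congr rfl fun m hm => ?_
        rw [MatInf.star_apply, hd t i m hij.1 (Finset.mem_range.mp hm),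
          hd t j k hij.2 (Finset.mem_range.mp hk)]
      rw [MatInf.sub_apply, MatInf.sub_apply, e2]
      simp only [v, MatInf.pad_apply, hij, and_self, dite_true, MatInf.trunc_apply,
        MatInf.mapₗ_apply, e1, map_sub, map_sum, Finset.sum_sub_distrib]
      abel
    · have (t : I) := ((hvn t).sub (hn t)) i j (by omega)
      simp only [this]
      exact tendsto_const_nhds
  obtain ⟨t, ht⟩ := ((Metric.tendsto_nhds.mp hlim) (ε / 2) (half_pos hε)).exists
  refine ⟨d t, ?_⟩
  rw [dist_zero_right] at ht
  have hw : n * (n * (|K| * ‖w‖)) ≤ ε / 2 := by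
    have : ‖w‖ * (n * (n * |K|) + 1) < ε / 2 := (lt_div_iff₀ (by positivity)).mp hc
    nlinarith [norm_nonneg w]
  calc ‖d t * b * star (d t) - a‖ = ‖v t - (v t - (d t * b * star (d t) - a))‖ := by
        rw [sub_sub_cancel]
    _ ≤ ‖v t‖ + ‖v t - (d t * b * star (d t) - a)‖ := norm_sub_le _ _
    _ < ε := by linarith [hv t]

end IsApproxRetraction

/-! ### Passing to the stabilization -/

/-- An `ε / 2` argument: the `T t` are uniformly Lipschitz, so convergence at a nearby point
suffices. Asymptotic relations on a completion thus need checking only on a dense subset. Only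
compatibility with subtraction is asked for, which covers the conjugate-linear terms coming from the
adjoint. -/
lemma isClosed_setOf_tendsto_zero {E F I : Type*} [SeminormedAddCommGroup E]
    [SeminormedAddCommGroup F] {l : Filter I} {T : I → E → F} {C : ℝ}
    (hT : ∀ t x y, T t (x - y) = T t x - T t y) (hC : ∀ t x, ‖T t x‖ ≤ C * ‖x‖) :
    IsClosed {x | Tendsto (fun t => T t x) l (𝓝 0)} := by
  refine isClosed_of_closure_subset fun x hx => ?_
  rw [Set.mem_ofPred_eq, Metric.tendsto_nhds]
  intro ε hε
  obtain ⟨y, hy, hxy⟩ := Metric.mem_closure_iff.mp hx (ε / 2 / (|C| + 1)) (by positivity)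
  filter_upwards [Metric.tendsto_nhds.mp hy (ε / 2) (half_pos hε)] with t ht
  rw [dist_zero_right] at ht ⊢
  rw [dist_eq_norm, lt_div_iff₀ (by positivity)] at hxy
  have h1 := hC t (x - y)
  rw [hT] at h1
  have h2 : C * ‖x - y‖ ≤ |C| * ‖x - y‖ := by gcongr; exact le_abs_self C
  have h3 := norm_add_le (T t x - T t y) (T t y)
  rw [sub_add_cancel] at h3
  nlinarith [norm_nonneg (x - y)]

namespace Stab

variable {A B : Type*} [NonUnitalCStarAlgebra A] [NonUnitalCStarAlgebra B]

/-- The inclusion of `M_∞(A)` in `𝒦 ⊗ A` as a continuous linear map. -/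
noncomputable def ofCLM : MatInf A →L[ℂ] Stab A where
  toFun := of
  map_add' := of_add
  map_smul' := of_smul
  cont := continuous_of

lemma denseRange_of : DenseRange (of : MatInf A → Stab A) := isDenseInducing_of.dense

lemma isUniformInducing_of : IsUniformInducing (of : MatInf A → Stab A) :=
  (AddMonoidHomClass.isometry_of_norm (ofCLM : MatInf A →L[ℂ] Stab A) norm_of).isUniformInducing

/-- The continuous extension to `𝒦 ⊗ A` of the entrywise application of a linear map `A → B`, if
the latter is bounded on `M_∞(A)`. -/
noncomputable def mapₗ (φ : A →ₗ[ℂ] B) (K : ℝ) (hφ : ∀ x, ‖MatInf.mapₗ φ x‖ ≤ K * ‖x‖) :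
    Stab A →L[ℂ] Stab B :=
  (ofCLM.comp ((MatInf.mapₗ φ).mkContinuous K hφ)).extend ofCLM

variable {φ : A →ₗ[ℂ] B} {K : ℝ} (hφ : ∀ x, ‖MatInf.mapₗ φ x‖ ≤ K * ‖x‖)

lemma mapₗ_of (a : MatInf A) : mapₗ φ K hφ (of a) = of (MatInf.mapₗ φ a) :=
  ContinuousLinearMap.extend_eq _ denseRange_of isUniformInducing_of a

lemma norm_mapₗ_le (x : Stab A) : ‖mapₗ φ K hφ x‖ ≤ K * ‖x‖ :=
  ind x (isClosed_le (by fun_prop) (by fun_prop)) fun a => by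
    rw [mapₗ_of, norm_of, norm_of]
    exact hφ a

lemma map_of (ψ : A →⋆ₙₐ[ℂ] B) (a : MatInf A) : map ψ (of a) = of (MatInf.map ψ a) :=
  UniformSpace.Completion.map_coe (MatInf.uniformContinuous_hom _) a

lemma of_sub (a b : MatInf A) : of (a - b) = of a - of b := map_sub ofHom a b

end Stab

namespace IsApproxRetraction

variable {B E I : Type*} [NonUnitalCStarAlgebra B] [NonUnitalCStarAlgebra E]
  {ι : B →⋆ₙₐ[ℂ] E} {l : Filter I} {φ : I → E →ₗ[ℂ] B} {K : ℝ}

/-- The bound `K` on `M_∞(E)`, uniform in the matrix size, is what lets `φ t` extend to the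
completion; on `M_∞(E)` itself every relation reduces to finitely many entries. -/
lemma stab (h : IsApproxRetraction ι l φ K) (hφ : ∀ t x, ‖MatInf.mapₗ (φ t) x‖ ≤ K * ‖x‖) :
    IsApproxRetraction (Stab.map ι) l (fun t => (Stab.mapₗ (φ t) K (hφ t)).toLinearMap) K where
  norm_le t x := Stab.norm_mapₗ_le (hφ t) x
  tendsto_mul x y := by
    have hb (t : I) (x : Stab E) : ‖Stab.mapₗ (φ t) K (hφ t) x‖ ≤ |K| * ‖x‖ :=
      (Stab.norm_mapₗ_le (hφ t) x).trans (by gcongr; exact le_abs_self K)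
    have hbound (t : I) (x y : Stab E) : ‖Stab.mapₗ (φ t) K (hφ t) (x * y) -
        Stab.mapₗ (φ t) K (hφ t) x * Stab.mapₗ (φ t) K (hφ t) y‖ ≤
        (|K| + |K| * |K|) * ‖x‖ * ‖y‖ := by
      calc _ ≤ |K| * (‖x‖ * ‖y‖) + (|K| * ‖x‖) * (|K| * ‖y‖) := by
            refine (norm_sub_le _ _).trans (add_le_add ((hb t _).trans ?_)
              ((norm_mul_le _ _).trans ?_))
            · gcongr
              exact norm_mul_le x y
            · gcongr
              · exact hb t x
              · exact hb t y
        _ = _ := by ring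
    simp only [ContinuousLinearMap.coe_coe]
    -- The expression is bilinear, so density is used in one variable at a time, with the other one
    -- fixed and absorbed in the constant.
    refine Stab.ind x (isClosed_setOf_tendsto_zero (C := (|K| + |K| * |K|) * ‖y‖)
      (fun t x x' => ?_) (fun t x => ?_)) fun a => Stab.ind y
        (isClosed_setOf_tendsto_zero (C := (|K| + |K| * |K|) * ‖Stab.of a‖)
        (fun t x x' => ?_) (fun t x => ?_)) fun b => ?_
    · simp only [sub_mul, map_sub]
      abel
    · exact (hbound t x y).trans_eq (by ring)
    · simp only [mul_sub, map_sub]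
      abel
    · exact hbound t _ x
    · simp only [← Stab.of_mul, Stab.mapₗ_of, ← Stab.of_sub]
      refine (Stab.continuous_of.tendsto 0).comp ?_
      obtain ⟨n, ha, hb⟩ := MatInf.exists_bdd₂ a b
      refine MatInf.tendsto_zero_of_entry (n := n)
        (fun t => ((ha.mul hb).mapₗ _).sub ((ha.mapₗ _).mul (hb.mapₗ _))) fun i j => ?_
      have := tendsto_finsetSum (Finset.range n) fun k _ =>
        h.tendsto_mul (a.entry i k) (b.entry k j)
      simp only [Finset.sum_const_zero] at this
      refine this.congr fun t => ?_
      rw [MatInf.sub_apply, MatInf.mapₗ_apply, MatInf.mul_apply_of_bdd (Or.inl ha),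
        MatInf.mul_apply_of_bdd (Or.inl (ha.mapₗ _)), map_sum, Finset.sum_sub_distrib]
      rfl
  tendsto_star x := by
    refine Stab.ind x (isClosed_setOf_tendsto_zero (C := K + K)
      (fun t x x' => ?_) (fun t x => ?_)) fun a => ?_
    · simp only [star_sub, map_sub]
      abel
    · refine (norm_sub_le _ _).trans ?_
      have h1 := Stab.norm_mapₗ_le (hφ t) (star x)
      have h2 := Stab.norm_mapₗ_le (hφ t) x
      rw [norm_star] at h1 ⊢
      rw [add_mul]
      exact add_le_add h1 h2
    · simp only [ContinuousLinearMap.coe_coe, ← Stab.of_star, Stab.mapₗ_of, ← Stab.of_sub]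
      refine (Stab.continuous_of.tendsto 0).comp ?_
      obtain ⟨n, ha⟩ := a.exists_bdd
      exact MatInf.tendsto_zero_of_entry (n := n) (fun t => (ha.star.mapₗ _).sub (ha.mapₗ _).star)
        fun i j => h.tendsto_star (a.entry j i)
  tendsto_leftInv x := by
    refine Stab.ind x (isClosed_setOf_tendsto_zero (C := |K| + 1)
      (fun t x x' => ?_) (fun t x => ?_)) fun a => ?_
    · simp only [map_sub]
      abel
    · refine (norm_sub_le _ _).trans ?_
      rw [add_mul, one_mul]
      refine add_le_add_left ((Stab.norm_mapₗ_le (hφ t) (Stab.map ι x)).trans ?_) _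
      gcongr
      · exact le_abs_self K
      · exact NonUnitalStarAlgHom.norm_apply_le (Stab.map ι) x
    · simp only [ContinuousLinearMap.coe_coe, Stab.map_of, Stab.mapₗ_of, ← Stab.of_sub]
      refine (Stab.continuous_of.tendsto 0).comp ?_
      obtain ⟨n, ha⟩ := a.exists_bdd
      exact MatInf.tendsto_zero_of_entry (n := n) (fun t => ((ha.map ι).mapₗ _).sub ha)
        fun i j => h.tendsto_leftInv (a.entry i j)

end IsApproxRetraction

/-! ### From reflection of the order to an isomorphism onto the range -/

namespace W

variable {A B : Type*} [NonUnitalCStarAlgebra A] [NonUnitalCStarAlgebra B]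

lemma isOrderIsoOntoRange_map (ψ : A →⋆ₙₐ[ℂ] B)
    (h : ∀ a b : MatInf A, (MatInf.map ψ a).CuntzSubeq (MatInf.map ψ b) → a.CuntzSubeq b) :
    IsOrderIsoOntoRange (map ψ) := by
  have hle (x y : W A) : map ψ x ≤ map ψ y ↔ x ≤ y := by
    induction x using ind with | h a ha => ?_
    induction y using ind with | h b hb => ?_
    rw [map_mk, map_mk, mk_le_mk, mk_le_mk]
    exact ⟨h a b, fun hab => hab.hom _⟩
  have hinj : Function.Injective (map ψ) := fun x y hxy =>
    le_antisymm ((hle x y).mp hxy.le) ((hle y x).mp hxy.ge)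
  have hbij : Function.Bijective (map ψ).mrangeRestrict :=
    ⟨fun x y hxy => hinj (congrArg Subtype.val hxy), (map ψ).mrangeRestrict_surjective⟩
  exact ⟨{ AddEquiv.ofBijective _ hbij with map_le_map_iff' := @hle }, fun x => rfl⟩

end W

/-! ### A criterion for complete contractivity -/

/-- A multiplicative constant disappears on taking `2 ^ k`-th roots: if `r < s`, then `K * (r / s) ^
2 ^ k` tends to `0` while staying at least `1`. -/
lemma le_of_forall_pow_two_pow_le {s r K : ℝ} (hr : 0 ≤ r)
    (h : ∀ k : ℕ, s ^ 2 ^ k ≤ K * r ^ 2 ^ k) : s ≤ r := by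
  by_contra! hrs
  have hs : 0 < s := hr.trans_lt hrs
  have hlim : Tendsto (fun k : ℕ => K * (r / s) ^ 2 ^ k) atTop (𝓝 (K * 0)) :=
    ((tendsto_pow_atTop_nhds_zero_of_lt_one (by positivity) ((div_lt_one hs).mpr hrs)).comp
      (tendsto_pow_atTop_atTop_of_one_lt one_lt_two)).const_mul K
  have hge (k : ℕ) : 1 ≤ K * (r / s) ^ 2 ^ k := by
    rw [div_pow, ← mul_div_assoc, one_le_div (by positivity)]
    exact h k
  have := ge_of_tendsto' hlim hge
  norm_num at this

attribute [local instance] CStarAlgebra.spectralOrder CStarAlgebra.spectralOrderedRing in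
lemma norm_mul_star_le_norm_sum {D ι : Type*} [NonUnitalCStarAlgebra D] (s : Finset ι)
    (f : ι → D) {i : ι} (hi : i ∈ s) : ‖f i * star (f i)‖ ≤ ‖∑ j ∈ s, f j * star (f j)‖ :=
  CStarAlgebra.norm_le_norm_of_nonneg_of_le (mul_star_self_nonneg _)
    (Finset.single_le_sum (f := fun j => f j * star (f j)) (fun _ _ => mul_star_self_nonneg _) hi)

namespace MatInf

variable {A B : Type*} [NonUnitalCStarAlgebra A] [NonUnitalCStarAlgebra B]

lemma norm_mapₗ_le_of_bdd {n : ℕ} {a : MatInf A} (ha : Bdd n a) {φ : A →ₗ[ℂ] B}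
    (hφ : ∀ x, ‖φ x‖ ≤ ‖x‖) : ‖mapₗ φ a‖ ≤ n * n * ‖a‖ := by
  rw [mul_assoc]
  exact norm_le_of_entry_le (ha.mapₗ φ) fun i j => (hφ _).trans (norm_entry_le a i j)

/-- A linear contraction `φ` with `φ(x) φ(x)^* ≤ φ(x x^*)`, in the weak sense of norms of matrices,
is completely contractive. -/
lemma norm_mapₗ_le_of_sq_le {φ : A →ₗ[ℂ] B} (hφ : ∀ x, ‖φ x‖ ≤ ‖x‖)
    (h : ∀ a : MatInf A, ‖mapₗ φ a‖ ^ 2 ≤ ‖mapₗ φ (a * star a)‖) (a : MatInf A) :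
    ‖mapₗ φ a‖ ≤ ‖a‖ := by
  obtain ⟨n, ha⟩ := a.exists_bdd
  -- The crude entrywise bound on `M_n(A)` costs a factor `n * n`. Passing from `a` to `a * star a`
  -- squares both norms without leaving `M_n(A)`, so the same factor serves all powers `2 ^ k`.
  refine le_of_forall_pow_two_pow_le (K := n * n) (norm_nonneg a) fun k => ?_
  induction k generalizing a with
  | zero => simpa using norm_mapₗ_le_of_bdd ha hφ
  | succ k ih =>
    have := ih (a * star a) (ha.mul ha.star)
    rw [CStarRing.norm_self_mul_star] at this
    rw [pow_succ', pow_mul, pow_mul, sq ‖a‖]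
    exact (pow_le_pow_left₀ (by positivity) (h a) _).trans this

end MatInf

/-! ### Coefficient maps of the crossed product -/

namespace CrossedProduct

variable {G A : Type*} [Group G]

section Coefficients

variable [Fintype G] [NonUnitalCStarAlgebra A] {α : G →* (A ≃⋆ₐ[ℂ] A)}

/-- The coefficient map `∑ a_h u_h ↦ a_g`. -/
def coeffₗ (α : G →* (A ≃⋆ₐ[ℂ] A)) (g : G) : CrossedProduct α →ₗ[ℂ] A where
  toFun x := x.coeff g
  map_add' _ _ := rfl
  map_smul' _ _ := rfl

-- Up to the isometry `α g⁻¹`, the coefficient at `g` is the `(g, 1)` entry of the regular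
-- representation.
attribute [local instance] CStarAlgebra.spectralOrder CStarAlgebra.spectralOrderedRing in
lemma norm_coeffₗ_le (g : G) (x : CrossedProduct α) : ‖coeffₗ α g x‖ ≤ ‖x‖ := by
  have h := CStarMatrix.norm_entry_le_norm (M := reg x) (i := g) (j := 1)
  rwa [reg_apply, inv_one, mul_one, StarAlgEquiv.norm_map] at h

/-- In `(x_g u_g) (y_h u_h)^*` the group element is `g h⁻¹`, so only `g = h` contributes, and there
the action cancels. -/
lemma mul_star_coeff_one (x y : CrossedProduct α) :
    (x * star y).coeff 1 = ∑ g, x.coeff g * star (y.coeff g) := by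
  rw [mul_coeff]
  refine Finset.sum_congr rfl fun g _ => ?_
  rw [star_coeff, action_action]
  simp

lemma mapₗ_coeffₗ_mul_star (a : MatInf (CrossedProduct α)) :
    MatInf.mapₗ (coeffₗ α 1) (a * star a) =
      ∑ g, MatInf.mapₗ (coeffₗ α g) a * star (MatInf.mapₗ (coeffₗ α g) a) := by
  obtain ⟨n, ha⟩ := a.exists_bdd
  ext i j
  rw [MatInf.mapₗ_apply, MatInf.mul_apply_of_bdd (Or.inl ha), MatInf.sum_apply, map_sum]
  simp only [MatInf.mul_apply_of_bdd (Or.inl (ha.mapₗ _))]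
  rw [Finset.sum_comm]
  refine Finset.sum_congr rfl fun k _ => ?_
  exact mul_star_coeff_one _ _

/-- One positive summand of `E(a a^*) = ∑ a_g a_g^*` is dominated by the whole sum. The comparison
of norms takes place in the C⋆-algebra `Stab A`, since `MatInf A` is not complete. -/
lemma sq_norm_mapₗ_coeffₗ_le (g : G) (a : MatInf (CrossedProduct α)) :
    ‖MatInf.mapₗ (coeffₗ α g) a‖ ^ 2 ≤ ‖MatInf.mapₗ (coeffₗ α 1) (a * star a)‖ := by
  have h := norm_mul_star_le_norm_sum Finset.univ
    (fun g => Stab.ofHom (MatInf.mapₗ (coeffₗ α g) a)) (Finset.mem_univ g)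
  simp only [← map_star, ← map_mul, ← map_sum, ← mapₗ_coeffₗ_mul_star] at h
  change ‖Stab.of _‖ ≤ ‖Stab.of _‖ at h
  rwa [Stab.norm_of, Stab.norm_of, CStarRing.norm_self_mul_star, ← sq] at h

/-- For `g = 1` the preceding inequality is the hypothesis of the squaring criterion; the other
coefficients are then controlled by the one at `1`, evaluated at `a * star a`. -/
lemma norm_mapₗ_coeffₗ_le (g : G) (a : MatInf (CrossedProduct α)) :
    ‖MatInf.mapₗ (coeffₗ α g) a‖ ≤ ‖a‖ := by
  refine (sq_le_sq₀ (norm_nonneg _) (norm_nonneg _)).mp ((sq_norm_mapₗ_coeffₗ_le g a).trans ?_)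
  refine (MatInf.norm_mapₗ_le_of_sq_le (norm_coeffₗ_le 1) (sq_norm_mapₗ_coeffₗ_le 1) _).trans ?_
  rw [CStarRing.norm_self_mul_star, sq]

end Coefficients

/-! ### Evaluating the crossed product at unitaries of `A` -/

section Unital

variable [CStarAlgebra A]

/-- The map is right multiplication by `diag(u, …, u)`, which does not change `a * star a`. -/
lemma norm_mapₗ_mulRight (u : unitary A) (a : MatInf A) :
    ‖MatInf.mapₗ (LinearMap.mulRight ℂ (u : A)) a‖ = ‖a‖ := by
  have h : MatInf.mapₗ (LinearMap.mulRight ℂ (u : A)) a *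
      star (MatInf.mapₗ (LinearMap.mulRight ℂ (u : A)) a) = a * star a := by
    obtain ⟨n, ha⟩ := a.exists_bdd
    ext i j
    rw [MatInf.mul_apply_of_bdd (Or.inl ha), MatInf.mul_apply_of_bdd (Or.inl (ha.mapₗ _))]
    refine Finset.sum_congr rfl fun k _ => ?_
    simp only [MatInf.star_apply, MatInf.mapₗ_apply, LinearMap.mulRight_apply, star_mul]
    rw [mul_assoc, ← mul_assoc (u : A), Unitary.mul_star_self_of_mem u.2, one_mul]
  have h' := congrArg norm h
  rw [CStarRing.norm_self_mul_star, CStarRing.norm_self_mul_star] at h'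
  exact (mul_self_inj (norm_nonneg _) (norm_nonneg _)).mp h'

lemma tendsto_mul_zero_of_norm_le {I : Type*} {l : Filter I} {f g : I → A} {C : ℝ}
    (hf : ∀ t, ‖f t‖ ≤ C) (hg : Tendsto g l (𝓝 0)) : Tendsto (fun t => f t * g t) l (𝓝 0) := by
  refine squeeze_zero_norm (a := fun t => C * ‖g t‖) (fun t => ?_)
    (by simpa using hg.norm.const_mul C)
  exact (norm_mul_le _ _).trans (by gcongr; exact hf t)

lemma tendsto_zero_mul_unitary {I : Type*} {l : Filter I} {f : I → A} (u : I → unitary A)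
    (hf : Tendsto f l (𝓝 0)) : Tendsto (fun t => f t * (u t : A)) l (𝓝 0) := by
  rw [tendsto_zero_iff_norm_tendsto_zero] at hf ⊢
  simpa only [CStarRing.norm_mul_coe_unitary] using hf

lemma tendsto_unitary_mul_zero {I : Type*} {l : Filter I} {f : I → A} (u : I → unitary A)
    (hf : Tendsto f l (𝓝 0)) : Tendsto (fun t => (u t : A) * f t) l (𝓝 0) := by
  rw [tendsto_zero_iff_norm_tendsto_zero] at hf ⊢
  simpa only [CStarRing.norm_coe_unitary_mul] using hf

variable {I : Type*} {l : Filter I} {z : I → G → unitary A}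

/-- Multiply `z_1 z_1 - z_1 → 0` on the left by `z_1^*`. -/
lemma tendsto_unitary_one
    (hz : ∀ g h, Tendsto (fun t => (z t g : A) * (z t h : A) - (z t (g * h) : A)) l (𝓝 0)) :
    Tendsto (fun t => (z t 1 : A) - 1) l (𝓝 0) := by
  have h := tendsto_unitary_mul_zero (fun t => star (z t 1)) (hz 1 1)
  refine h.congr fun t => ?_
  rw [mul_one, mul_sub, ← mul_assoc, Unitary.coe_star, Unitary.coe_star_mul_self, one_mul]

variable [Fintype G] (α : G →* (A ≃⋆ₐ[ℂ] A))

/-- The linear map `∑ a_g u_g ↦ ∑ a_g z_g`. -/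
noncomputable def eval (z : G → unitary A) : CrossedProduct α →ₗ[ℂ] A where
  toFun x := ∑ g, x.coeff g * (z g : A)
  map_add' x y := by simp [add_mul, Finset.sum_add_distrib]
  map_smul' r x := by simp [Finset.smul_sum]

variable {α}

lemma eval_apply (z : G → unitary A) (x : CrossedProduct α) :
    eval α z x = ∑ g, x.coeff g * (z g : A) := rfl

lemma norm_mapₗ_eval_le (z : G → unitary A) (a : MatInf (CrossedProduct α)) :
    ‖MatInf.mapₗ (eval α z) a‖ ≤ Fintype.card G * ‖a‖ := by
  have h : MatInf.mapₗ (eval α z) a = ∑ g, MatInf.mapₗ (LinearMap.mulRight ℂ (z g : A))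
      (MatInf.mapₗ (coeffₗ α g) a) := by
    ext i j
    rw [MatInf.sum_apply]
    rfl
  rw [h]
  refine (norm_sum_le_of_le _ fun g _ => (norm_mapₗ_mulRight (z g) _).trans_le
    (norm_mapₗ_coeffₗ_le g a)).trans_eq ?_
  simp

lemma norm_eval_le (z : G → unitary A) (x : CrossedProduct α) :
    ‖eval α z x‖ ≤ Fintype.card G * ‖x‖ := by
  rw [eval_apply]
  refine (norm_sum_le_of_le (f := fun g => x.coeff g * (z g : A)) _ fun g _ =>
    (CStarRing.norm_mul_coe_unitary _ (z g)).trans_le (norm_coeffₗ_le g x)).trans_eq ?_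
  simp

/-- If `a ↦ z_g a z_g^*` converges to `α_g`, and `g ↦ z_g` is asymptotically multiplicative, then the
maps `∑ a_g u_g ↦ ∑ a_g z_g` are asymptotically ⋆-homomorphisms that split the inclusion of `A`. -/
lemma isApproxRetraction_eval
    (hα : ∀ g a, Tendsto (fun t => α g a - (z t g : A) * a * star (z t g : A)) l (𝓝 0))
    (hz : ∀ g h, Tendsto (fun t => (z t g : A) * (z t h : A) - (z t (g * h) : A)) l (𝓝 0)) :
    IsApproxRetraction (incl α) l (fun t => eval α (z t)) (Fintype.card G) where
  norm_le t x := norm_eval_le (z t) x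
  tendsto_mul x y := by
    have key (g h : G) : Tendsto (fun t => x.coeff g * α g (y.coeff h) * (z t (g * h) : A) -
        x.coeff g * (z t g : A) * (y.coeff h * (z t h : A))) l (𝓝 0) := by
      -- With `y` for `y.coeff h`, the difference of `(α_g(y) - z_g y z_g^*) z_{gh}` and `z_g y
      -- z_g^* (z_g z_h - z_{gh})` is `α_g(y) z_{gh} - z_g y z_h`.
      have h1 := tendsto_zero_mul_unitary (fun t => z t (g * h)) (hα g (y.coeff h))
      have h2 := tendsto_mul_zero_of_norm_le
        (f := fun t => (z t g : A) * y.coeff h * (star (z t g) : unitary A)) (C := ‖y.coeff h‖)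
        (fun t => by rw [CStarRing.norm_mul_coe_unitary, CStarRing.norm_coe_unitary_mul]) (hz g h)
      have h3 := (h1.sub h2).const_mul (x.coeff g)
      rw [sub_zero, mul_zero] at h3
      refine h3.congr fun t => ?_
      have e : star (z t g : A) * ((z t g : A) * (z t h : A)) = z t h := by
        rw [← mul_assoc, Unitary.coe_star_mul_self, one_mul]
      rw [Unitary.coe_star, mul_assoc _ (star (z t g : A)), mul_sub (star (z t g : A)), e]
      noncomm_ring
    have hsum := tendsto_finsetSum Finset.univ fun g _ =>
      tendsto_finsetSum Finset.univ fun h _ => key g h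
    simp only [Finset.sum_const_zero] at hsum
    refine hsum.congr fun t => ?_
    have e1 : eval α (z t) (x * y) =
        ∑ g, ∑ h, x.coeff g * α g (y.coeff h) * (z t (g * h) : A) := by
      simp only [eval_apply, mul_coeff, Finset.sum_mul]
      rw [Finset.sum_comm]
      refine Finset.sum_congr rfl fun g _ => ?_
      refine Fintype.sum_equiv (Equiv.mulLeft g⁻¹) _ _ fun h => ?_
      simp
    have e2 : eval α (z t) x * eval α (z t) y =
        ∑ g, ∑ h, x.coeff g * (z t g : A) * (y.coeff h * (z t h : A)) := by
      simp only [eval_apply, Finset.sum_mul_sum]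
    simp only [e1, e2, Finset.sum_sub_distrib]
  tendsto_star x := by
    have key (g : G) : Tendsto (fun t => α g (star (x.coeff g⁻¹)) * (z t g : A) -
        star (z t g⁻¹ : A) * star (x.coeff g⁻¹)) l (𝓝 0) := by
      set y := star (x.coeff g⁻¹)
      have h1 := tendsto_zero_mul_unitary (fun t => z t g) (hα g y)
      -- This says `z_g z_{g⁻¹} → 1`. Multiplying by `z_{g⁻¹}^*` on the right gives `z_g - z_{g⁻¹}^*
      -- → 0`, which turns the limit `α_g(y) z_g - z_g y → 0` of `h1` into the claim.
      have h0 := (hz g g⁻¹).add (tendsto_unitary_one hz)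
      rw [add_zero] at h0
      have h2 := (tendsto_zero_mul_unitary (fun t => star (z t g⁻¹)) h0).mul_const y
      have h3 := h1.add h2
      rw [zero_mul, add_zero] at h3
      refine h3.congr fun t => ?_
      have e1 : star (z t g : A) * (z t g : A) = 1 := Unitary.star_mul_self_of_mem (z t g).2
      have e2 : (z t g⁻¹ : A) * star (z t g⁻¹ : A) = 1 := Unitary.mul_star_self_of_mem (z t g⁻¹).2
      simp only [Unitary.coe_star, mul_inv_cancel, sub_mul, add_mul, one_mul, mul_assoc, e1]
      rw [← mul_assoc (z t g⁻¹ : A), e2, mul_one, one_mul]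
      abel
    have hsum := tendsto_finsetSum Finset.univ fun g _ => key g
    simp only [Finset.sum_const_zero] at hsum
    refine hsum.congr fun t => ?_
    rw [Finset.sum_sub_distrib, eval_apply, eval_apply, star_sum]
    congr 1
    refine Fintype.sum_equiv (Equiv.inv G) _ _ fun g => ?_
    simp
  tendsto_leftInv a := by
    have h := (tendsto_unitary_one hz).const_mul a
    rw [mul_zero] at h
    refine h.congr fun t => ?_
    rw [eval_apply, Finset.sum_eq_single 1]
    · simp [incl, mul_sub]
    · intro g _ hg
      simp [incl, hg]
    · simp

end Unital

end CrossedProduct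

/-! ### The net of unitaries and the conclusion -/

/-- Since `A` need not be separable, a net is used, indexed by a finite set `F` and the tolerance `1
/ (n + 1)`; each `a` lies in `F` eventually. -/
lemma StrictlyApproxInner.exists_unitary {G A : Type*} [Group G] [CStarAlgebra A]
    {α : G →* (A ≃⋆ₐ[ℂ] A)} (hα : StrictlyApproxInner α) :
    ∃ z : Finset A × ℕ → G → unitary A,
      (∀ g a, Tendsto (fun t => α g a - (z t g : A) * a * star (z t g : A)) atTop (𝓝 0)) ∧
      ∀ g h, Tendsto (fun t => (z t g : A) * (z t h : A) - (z t (g * h) : A)) atTop (𝓝 0) := by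
  choose z hz hz' using fun t : Finset A × ℕ => hα t.1 (1 / ((t.2 : ℝ) + 1)) (by positivity)
  have hsnd : Tendsto (Prod.snd : Finset A × ℕ → ℕ) atTop atTop := by
    rw [← prod_atTop_atTop_eq]
    exact tendsto_snd
  have hlim : Tendsto (fun t : Finset A × ℕ => 1 / ((t.2 : ℝ) + 1)) atTop (𝓝 0) :=
    tendsto_one_div_add_atTop_nhds_zero_nat.comp hsnd
  refine ⟨z, fun g a => ?_, fun g h => squeeze_zero_norm (fun t => (hz' t g h).le) hlim⟩
  refine squeeze_zero_norm' ?_ hlim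
  filter_upwards [eventually_ge_atTop (({a} : Finset A), 0)] with t ht
  exact (hz t g a (ht.1 (Finset.mem_singleton_self a))).le

theorem mainTheorem1 {G : Type*} [Group G] [Fintype G] {A : Type*} [CStarAlgebra A]
    (α : G →* (A ≃⋆ₐ[ℂ] A)) (hα : StrictlyApproxInner α) :
    IsOrderIsoOntoRange (W.map (CrossedProduct.incl α)) ∧
      IsOrderIsoOntoRange (Cu.map (CrossedProduct.incl α)) := by
  classical
  obtain ⟨z, hz, hz'⟩ := hα.exists_unitary
  have h := CrossedProduct.isApproxRetraction_eval hz hz'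
  exact ⟨W.isOrderIsoOntoRange_map _ fun _ _ => h.cuntzSubeq,
    W.isOrderIsoOntoRange_map _ fun _ _ =>
      (h.stab fun t => CrossedProduct.norm_mapₗ_eval_le (z t)).cuntzSubeq⟩
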